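/- Let $\Bbbk$ be a commutative ring. A graded supercategory is a $\Bbbk$-linear category whose morphism modules are graded by $\mathbb Z\oplus\mathbb Z/2$ (degree, parity), with identities of degree $0$ and even, and with degrees and parities adding under composition. A graded superfunctor is a $\Bbbk$-linear functor preserving degrees and parities. A supernatural transformation $x:F\Rightarrow G$ of degree $n$ and parity $p$ is a family of morphisms $x_\lambda:F\lambda\to G\lambda$ of degree $n$ and parity $p$ with $x_\mu\circ Ff=(-1)^{p|f|}\,Gf\circ x_\lambda$ for all homogeneous $f:\lambda\to\mu$. Juxtaposition denotes horizontal composition, $(yx)_\lambda=y_{H\lambda}\circ Gx_\lambda$ for $x:F\Rightarrow H$ and $y:G\Rightarrow K$. A graded $(Q,\Pi)$-supercategory is a graded supercategory $\mathcal A$ with graded superfunctors $Q,Q^{-1},\Pi:\mathcal A\to\mathcal A$, an odd supernatural isomorphism $\zeta:\Pi\Rightarrow I$ of degree $0$, and even supernatural isomorphisms $\sigma:Q\Rightarrow I$ and $\bar\sigma:Q^{-1}\Rightarrow I$ of degrees $-1$ and $1$. Let $(Q,\Pi)\text{-}\underline{\mathfrak{GSCat}}$ be the strict 2-category of graded $(Q,\Pi)$-supercategories,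 (arbitrary) graded superfunctors, and even supernatural transformations of degree $0$. A $(Q,\Pi)$-category is a $\Bbbk$-linear category $\mathcal A$ with $\Bbbk$-linear endofunctors $\Pi,Q,Q^{-1}$ and natural isomorphisms $\xi:\Pi^2\Rightarrow I$, $\imath:Q^{-1}Q\Rightarrow I$, $\jmath:QQ^{-1}\Rightarrow I$, $\beta_Q:\Pi Q\Rightarrow Q\Pi$ such that $\xi\Pi=\Pi\xi$, $\imath^{-1}$ and $\jmath$ are unit and counit of an adjunction $(Q,Q^{-1})$, and $\xi Q\xi^{-1}=\beta_Q\Pi\circ\Pi\beta_Q$. A $(Q,\Pi)$-functor $F:\mathcal A\to\mathcal A'$ is a $\Bbbk$-linear functor with natural isomorphisms $\beta_F:\Pi'F\Rightarrow F\Pi$ and $\gamma_F:Q'F\Rightarrow FQ$ such that $$\xi'F\xi^{-1}=\beta_F\Pi\circ\Pi'\beta_F,\qquad F\beta_Q\circ\beta_FQ\circ\Pi'\gamma_F=\gamma_F\Pi\circ Q'\beta_F\circ\beta_{Q'}F .$$ A $(Q,\Pi)$-natural transformation $x:F\Rightarrow G$ is a natural transformation with $x\Pi\circ\beta_F=\beta_G\circ\Pi'x$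 and $xQ\circ\gamma_F=\gamma_G\circ Q'x$. With $\beta_I=1$, $\gamma_I=1$, $\beta_{GF}=G\beta_F\circ\beta_GF$ and $\gamma_{GF}=G\gamma_F\circ\gamma_GF$ these form a strict 2-category $(Q,\Pi)\text{-}\mathfrak{Cat}$. There is a strict 2-functor $$\mathbb E:(Q,\Pi)\text{-}\underline{\mathfrak{GSCat}}\to(Q,\Pi)\text{-}\mathfrak{Cat}$$ sending $\mathcal A$ to its underlying category $\underline{\mathcal A}$ (same objects, even morphisms of degree $0$) with the restrictions of $\Pi,Q,Q^{-1}$ and with $\xi=\zeta\zeta$, $\imath=\bar\sigma\sigma$, $\jmath=\sigma\bar\sigma$, $\beta_Q=-\zeta Q\zeta^{-1}$; sending a graded superfunctor $F$ to its restriction $\underline F$ with $\beta_F=-\zeta'F\zeta^{-1}$ and $\gamma_F=\sigma'F\sigma^{-1}$; and sending $x$ to $\underline x$ with $\underline x_\lambda=x_\lambda$. **Theorem.** $\mathbb E$ is a 2-equivalence: there is a 2-functor (pseudofunctor) $\mathbb D:(Q,\Pi)\text{-}\mathfrak{Cat}\to(Q,\Pi)\text{-}\underline{\mathfrak{GSCat}}$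 such that $\mathbb E\circ\mathbb D$ and $\mathbb D\circ\mathbb E$ are equivalent to the identity 2-functors in the respective 2-categories of 2-functors, strong (pseudonatural) transformations and modifications. -/

import Mathlib

open CategoryTheory
open scoped Bicategory Pseudofunctor.StrongTrans

universe w w₁ w₂ v v₁ v₂ u u₁ u₂

namespace QPi

noncomputable section

/-! ## Graded supercategories -/

/-- A graded supercategory over `k`: a `k`-linear category whose morphism modules are graded by
`ℤ × ℤ/2` (degree, parity), with identities even of degree zero and composition additive on
degrees and parities. -/
class GradedSupercategory (k : Type w) [CommRing k] (C : Type u) [Category.{v} C]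
    [Preadditive C] [Linear k C] where
  /-- `homog X Y (n, p)` consists of the morphisms of degree `n` and parity `p`. -/
  homog : ∀ X Y : C, ℤ × ZMod 2 → Submodule k (X ⟶ Y)
  isInternal : ∀ X Y : C, DirectSum.IsInternal (homog X Y)
  id_mem : ∀ X : C, 𝟙 X ∈ homog X X 0
  comp_mem : ∀ {X Y Z : C} {i j : ℤ × ZMod 2} {f : X ⟶ Y} {g : Y ⟶ Z},
    f ∈ homog X Y i → g ∈ homog Y Z j → f ≫ g ∈ homog X Z (i + j)

/-- The submodule of homogeneous morphisms of given degree and parity. -/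
abbrev homog (k : Type w) [CommRing k] {C : Type u} [Category.{v} C]
    [Preadditive C] [Linear k C] [GradedSupercategory k C] (X Y : C) (i : ℤ × ZMod 2) :
    Submodule k (X ⟶ Y) :=
  GradedSupercategory.homog X Y i

/-- A graded superfunctor: a `k`-linear functor preserving degrees and parities of morphisms. -/
structure IsGradedSuperfunctor (k : Type w) [CommRing k]
    {C : Type u₁} [Category.{v₁} C] [Preadditive C] [Linear k C] [GradedSupercategory k C]
    {D : Type u₂} [Category.{v₂} D] [Preadditive D] [Linear k D] [GradedSupercategory k D]
    (F : C ⥤ D) : Prop where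
  additive : F.Additive
  linear : F.Linear k
  map_mem : ∀ {X Y : C} {i : ℤ × ZMod 2} {f : X ⟶ Y},
    f ∈ homog k X Y i → F.map f ∈ homog k (F.obj X) (F.obj Y) i

/-- `x` is a supernatural transformation `F ⇒ G` that is homogeneous of degree `n` and
parity `p`: `x_Y ∘ F f = (-1)^{p|f|} G f ∘ x_X`. -/
structure IsSupernatural (k : Type w) [CommRing k]
    {C : Type u₁} [Category.{v₁} C] [Preadditive C] [Linear k C] [GradedSupercategory k C]
    {D : Type u₂} [Category.{v₂} D] [Preadditive D] [Linear k D] [GradedSupercategory k D]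
    (F G : C ⥤ D) (n : ℤ) (p : ZMod 2) (x : ∀ X, F.obj X ⟶ G.obj X) : Prop where
  mem : ∀ X, x X ∈ homog k (F.obj X) (G.obj X) (n, p)
  comm : ∀ {X Y : C} {m : ℤ} {q : ZMod 2} {f : X ⟶ Y}, f ∈ homog k X Y (m, q) →
    F.map f ≫ x Y = (-1 : ℤ) ^ (p.val * q.val) • (x X ≫ G.map f)

lemma IsSupernatural.of_natural {k : Type w} [CommRing k]
    {C : Type u₁} [Category.{v₁} C] [Preadditive C] [Linear k C] [GradedSupercategory k C]
    {D : Type u₂} [Category.{v₂} D] [Preadditive D] [Linear k D] [GradedSupercategory k D]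
    {F G : C ⥤ D} {x : ∀ X, F.obj X ⟶ G.obj X}
    (hx : ∀ X, x X ∈ homog k (F.obj X) (G.obj X) 0)
    (h : ∀ {X Y : C} (f : X ⟶ Y), F.map f ≫ x Y = x X ≫ G.map f) :
    IsSupernatural k F G 0 0 x where
  mem := hx
  comm {X Y m q f} _ := by simp [h f]

section Homogeneous

variable {k : Type w} [CommRing k] {C : Type u} [Category.{v} C]
    [Preadditive C] [Linear k C] [GradedSupercategory k C]

lemma hom_induction {X Y : C} {P : (X ⟶ Y) → Prop} (h0 : P 0)
    (hadd : ∀ f g, P f → P g → P (f + g)) (hh : ∀ i, ∀ f ∈ homog k X Y i, P f)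
    (f : X ⟶ Y) : P f := by
  have hf : f ∈ iSup (homog k X Y) := by
    rw [(GradedSupercategory.isInternal (k := k) X Y).submodule_iSup_eq_top]
    trivial
  exact Submodule.iSup_induction _ (motive := P) hf hh h0 hadd

/-- The inverse of a homogeneous isomorphism is homogeneous. -/
lemma inv_mem {X Y : C} (e : X ≅ Y) {i : ℤ × ZMod 2} (he : e.hom ∈ homog k X Y i) :
    e.inv ∈ homog k Y X (-i) := by
  classical
  let d1 := (GradedSupercategory.isInternal (k := k) Y X).chooseDecomposition
  let d2 := (GradedSupercategory.isInternal (k := k) X X).chooseDecomposition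
  have key : ∀ g : Y ⟶ X,
      ((DirectSum.decompose (homog k X X) (e.hom ≫ g)) 0 : X ⟶ X) =
        e.hom ≫ ((DirectSum.decompose (homog k Y X) g) (-i) : Y ⟶ X) := by
    intro g
    refine hom_induction (k := k) (P := fun g =>
      ((DirectSum.decompose (homog k X X) (e.hom ≫ g)) 0 : X ⟶ X) =
        e.hom ≫ ((DirectSum.decompose (homog k Y X) g) (-i) : Y ⟶ X)) ?_ (fun f g hf hg => ?_) (fun j g hg => ?_) g
    · simp
    · simp only [Preadditive.comp_add, DirectSum.decompose_add, DirectSum.add_apply,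
        Submodule.coe_add, hf, hg]
    · have hc := GradedSupercategory.comp_mem he hg
      by_cases hj : j = -i
      · subst hj
        rw [add_neg_cancel] at hc
        rw [DirectSum.decompose_of_mem_same _ hc, DirectSum.decompose_of_mem_same _ hg]
      · rw [DirectSum.decompose_of_mem_ne _ hc, DirectSum.decompose_of_mem_ne _ hg hj,
          Limits.comp_zero]
        intro h
        exact hj (eq_neg_of_add_eq_zero_right h)
  have h1 := key e.inv
  rw [e.hom_inv_id,
    DirectSum.decompose_of_mem_same _ (GradedSupercategory.id_mem (k := k) X)] at h1
  have h2 : e.inv = ((DirectSum.decompose (homog k Y X) e.inv) (-i) : Y ⟶ X) := by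
    rw [← cancel_epi e.hom, ← h1, e.hom_inv_id]
  rw [h2]
  exact SetLike.coe_mem _

end Homogeneous

/-! ### The underlying category -/

/-- The underlying category of a graded supercategory: same objects, but only the even morphisms
of degree zero. -/
structure Underlying (k : Type w) [CommRing k] (C : Type u) : Type u where
  /-- An object of the graded supercategory, viewed in its underlying category. -/
  of ::
  /-- The corresponding object of the graded supercategory. -/
  as : C

namespace Underlying

variable {k : Type w} [CommRing k] {C : Type u} [Category.{v} C]
    [Preadditive C] [Linear k C] [GradedSupercategory k C]

instance : Category.{v} (Underlying k C) where
  Hom X Y := homog k X.as Y.as 0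
  id X := ⟨𝟙 X.as, GradedSupercategory.id_mem X.as⟩
  comp f g := ⟨f.1 ≫ g.1, by simpa using GradedSupercategory.comp_mem f.2 g.2⟩
  id_comp f := Subtype.ext (Category.id_comp f.1)
  comp_id f := Subtype.ext (Category.comp_id f.1)
  assoc f g h := Subtype.ext (Category.assoc f.1 g.1 h.1)

instance : Preadditive (Underlying k C) where
  homGroup X Y := inferInstanceAs (AddCommGroup (homog k X.as Y.as 0))
  add_comp _ _ _ f f' g := Subtype.ext (Preadditive.add_comp _ _ _ f.1 f'.1 g.1)
  comp_add _ _ _ f g g' := Subtype.ext (Preadditive.comp_add _ _ _ f.1 g.1 g'.1)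

instance : Linear k (Underlying k C) where
  homModule X Y := inferInstanceAs (Module k (homog k X.as Y.as 0))
  smul_comp _ _ _ r f g := Subtype.ext (Linear.smul_comp _ _ _ r f.1 g.1)
  comp_smul _ _ _ f r g := Subtype.ext (Linear.comp_smul _ _ _ f.1 r g.1)

/-- The morphism of the ambient graded supercategory underlying a morphism of its underlying
category. -/
def val {X Y : Underlying k C} (f : X ⟶ Y) : X.as ⟶ Y.as := f.1

lemma val_mem {X Y : Underlying k C} (f : X ⟶ Y) : val f ∈ homog k X.as Y.as 0 := f.2

/-- An even morphism of degree zero, viewed in the underlying category. -/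
def mk {X Y : Underlying k C} (f : X.as ⟶ Y.as) (hf : f ∈ homog k X.as Y.as 0) : X ⟶ Y :=
  ⟨f, hf⟩

@[simp] lemma val_mk {X Y : Underlying k C} (f : X.as ⟶ Y.as) (hf : f ∈ homog k X.as Y.as 0) :
    val (mk f hf : X ⟶ Y) = f := rfl

@[simp] lemma val_id (X : Underlying k C) : val (𝟙 X) = 𝟙 X.as := rfl

@[simp] lemma val_comp {X Y Z : Underlying k C} (f : X ⟶ Y) (g : Y ⟶ Z) :
    val (f ≫ g) = val f ≫ val g := rfl

lemma hom_ext {X Y : Underlying k C} {f g : X ⟶ Y} (h : val f = val g) : f = g :=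
  Subtype.ext h

/-- An even isomorphism of degree zero gives an isomorphism in the underlying category. -/
def isoMk {X Y : Underlying k C} (e : X.as ≅ Y.as) (he : e.hom ∈ homog k X.as Y.as 0) :
    X ≅ Y where
  hom := mk e.hom he
  inv := mk e.inv (by simpa using inv_mem e he)
  hom_inv_id := hom_ext e.hom_inv_id
  inv_hom_id := hom_ext e.inv_hom_id

@[simp] lemma val_isoMk_hom {X Y : Underlying k C} (e : X.as ≅ Y.as)
    (he : e.hom ∈ homog k X.as Y.as 0) : val (isoMk e he : X ≅ Y).hom = e.hom := rfl

@[simp] lemma val_isoMk_inv {X Y : Underlying k C} (e : X.as ≅ Y.as)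
    (he : e.hom ∈ homog k X.as Y.as 0) : val (isoMk e he : X ≅ Y).inv = e.inv := rfl

variable {D : Type u₂} [Category.{v₂} D] [Preadditive D] [Linear k D]
  [GradedSupercategory k D]

/-- The restriction of a graded superfunctor to the underlying categories. -/
def functor (F : C ⥤ D) (hF : IsGradedSuperfunctor k F) :
    Underlying k C ⥤ Underlying k D where
  obj X := of (F.obj X.as)
  map f := mk (F.map (val f)) (hF.map_mem (val_mem f))
  map_id X := hom_ext (F.map_id X.as)
  map_comp f g := hom_ext (F.map_comp (val f) (val g))

@[simp] lemma functor_obj_as (F : C ⥤ D) (hF : IsGradedSuperfunctor k F)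
    (X : Underlying k C) : ((functor F hF).obj X).as = F.obj X.as := rfl

@[simp] lemma val_functor_map (F : C ⥤ D) (hF : IsGradedSuperfunctor k F)
    {X Y : Underlying k C} (f : X ⟶ Y) :
    val ((functor F hF).map f) = F.map (val f) := rfl

lemma functor_additive (F : C ⥤ D) (hF : IsGradedSuperfunctor k F) :
    (functor F hF).Additive where
  map_add {_ _ f g} := hom_ext (by have := hF.additive; exact F.map_add (f := val f) (g := val g))

lemma functor_linear (F : C ⥤ D) (hF : IsGradedSuperfunctor k F) :
    (functor F hF).Linear k where
  map_smul f r := hom_ext (by have := hF.linear; exact F.map_smul r (val f))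

end Underlying

/-! ## The 2-category of graded `(Q, Π)`-supercategories -/

/-- A graded `(Q, Π)`-supercategory: a graded supercategory with graded superfunctors
`Q`, `Q⁻¹`, `Π`, an odd supernatural isomorphism `ζ : Π ⇒ I` of degree `0` and even supernatural
isomorphisms `σ : Q ⇒ I`, `σ' : Q⁻¹ ⇒ I` of degrees `-1` and `1`. -/
structure QPSupercat (k : Type w) [CommRing k] where
  carrier : Type u
  [cat : Category.{v} carrier]
  [preadditive : Preadditive carrier]
  [linear : Linear k carrier]
  [graded : GradedSupercategory k carrier]
  Q : carrier ⥤ carrier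
  Qinv : carrier ⥤ carrier
  P : carrier ⥤ carrier
  hQ : IsGradedSuperfunctor k Q
  hQinv : IsGradedSuperfunctor k Qinv
  hP : IsGradedSuperfunctor k P
  ζ : ∀ X, P.obj X ≅ X
  σ : ∀ X, Q.obj X ≅ X
  σ' : ∀ X, Qinv.obj X ≅ X
  hζ : IsSupernatural k P (𝟭 carrier) 0 1 fun X => (ζ X).hom
  hσ : IsSupernatural k Q (𝟭 carrier) (-1) 0 fun X => (σ X).hom
  hσ' : IsSupernatural k Qinv (𝟭 carrier) 1 0 fun X => (σ' X).hom

attribute [instance] QPSupercat.cat QPSupercat.preadditive QPSupercat.linear QPSupercat.graded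

/-- Graded superfunctors between graded `(Q, Π)`-supercategories; no compatibility with `Q`, `Π`
is required. -/
@[ext]
structure GSFunctor {k : Type w} [CommRing k] (A B : QPSupercat.{w, v, u} k) where
  functor : A.carrier ⥤ B.carrier
  isSuper : IsGradedSuperfunctor k functor

/-- Even supernatural transformations of degree zero. -/
@[ext]
structure GSTrans {k : Type w} [CommRing k] {A B : QPSupercat.{w, v, u} k}
    (F G : GSFunctor A B) where
  app : ∀ X, F.functor.obj X ⟶ G.functor.obj X
  isSupernatural : IsSupernatural k F.functor G.functor 0 0 app

section Supercat

variable {k : Type w} [CommRing k]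

lemma isSupernatural_id {A B : QPSupercat.{w, v, u} k} (F : GSFunctor A B) :
    IsSupernatural k F.functor F.functor 0 0 fun X => 𝟙 (F.functor.obj X) where
  mem X := GradedSupercategory.id_mem _
  comm _ := by simp

lemma isSupernatural_comp {A B : QPSupercat.{w, v, u} k} {F G H : GSFunctor A B}
    (x : GSTrans F G) (y : GSTrans G H) :
    IsSupernatural k F.functor H.functor 0 0 fun X => x.app X ≫ y.app X where
  mem X := by
    simpa using GradedSupercategory.comp_mem (x.isSupernatural.mem X) (y.isSupernatural.mem X)
  comm hf := by
    have h1 := x.isSupernatural.comm hf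
    have h2 := y.isSupernatural.comm hf
    simp only [ZMod.val_zero, zero_mul, pow_zero, one_smul] at h1 h2 ⊢
    rw [← Category.assoc, h1, Category.assoc, h2, Category.assoc]

/-- An even supernatural transformation of degree zero is natural with respect to all
morphisms. -/
lemma GSTrans.naturality {A B : QPSupercat.{w, v, u} k} {F G : GSFunctor A B} (x : GSTrans F G)
    {X Y : A.carrier} (f : X ⟶ Y) :
    F.functor.map f ≫ x.app Y = x.app X ≫ G.functor.map f := by
  have := F.isSuper.additive
  have := G.isSuper.additive
  refine hom_induction (k := k)
    (P := fun f => F.functor.map f ≫ x.app Y = x.app X ≫ G.functor.map f) ?_ (fun f g hf hg => ?_) (fun i f hf => ?_) f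
  · simp
  · simp [hf, hg]
  · have := x.isSupernatural.comm (m := i.1) (q := i.2) hf
    simpa using this

instance (A B : QPSupercat.{w, v, u} k) : Category (GSFunctor A B) where
  Hom F G := GSTrans F G
  id F := ⟨_, isSupernatural_id F⟩
  comp x y := ⟨_, isSupernatural_comp x y⟩

@[ext]
lemma GSTrans.hom_ext {A B : QPSupercat.{w, v, u} k} {F G : GSFunctor A B} {x y : F ⟶ G}
    (h : ∀ X, GSTrans.app x X = GSTrans.app y X) : x = y :=
  GSTrans.ext (funext h)

@[simp] lemma GSTrans.id_app {A B : QPSupercat.{w, v, u} k} (F : GSFunctor A B) (X) :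
    GSTrans.app (𝟙 F) X = 𝟙 (F.functor.obj X) := rfl

@[simp] lemma GSTrans.comp_app {A B : QPSupercat.{w, v, u} k} {F G H : GSFunctor A B}
    (x : F ⟶ G) (y : G ⟶ H) (X) :
    GSTrans.app (x ≫ y) X = GSTrans.app x X ≫ GSTrans.app y X := rfl

/-- The identity graded superfunctor. -/
def GSFunctor.id (A : QPSupercat.{w, v, u} k) : GSFunctor A A where
  functor := 𝟭 _
  isSuper := { additive := inferInstance, linear := inferInstance, map_mem := fun h => h }

/-- Composition of graded superfunctors, in diagrammatic order. -/
def GSFunctor.comp {A B C : QPSupercat.{w, v, u} k} (F : GSFunctor A B) (G : GSFunctor B C) :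
    GSFunctor A C where
  functor := F.functor ⋙ G.functor
  isSuper :=
    { additive := by have := F.isSuper.additive; have := G.isSuper.additive; infer_instance
      linear := by have := F.isSuper.linear; have := G.isSuper.linear; infer_instance
      map_mem := fun h => G.isSuper.map_mem (F.isSuper.map_mem h) }

/-- `Gx` for a superfunctor `G` and a transformation `x`. -/
def GSTrans.postcomp {A B C : QPSupercat.{w, v, u} k} {F G : GSFunctor A B} (x : F ⟶ G)
    (H : GSFunctor B C) : F.comp H ⟶ G.comp H where
  app X := H.functor.map (GSTrans.app x X)
  isSupernatural := .of_natural (fun X => H.isSuper.map_mem (x.isSupernatural.mem X))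
    (fun f => by
      have := congrArg H.functor.map (GSTrans.naturality x f)
      simpa [GSFunctor.comp] using this)

/-- `xF` for a superfunctor `F` and a transformation `x`. -/
def GSTrans.precomp {A B C : QPSupercat.{w, v, u} k} (F : GSFunctor A B)
    {G H : GSFunctor B C} (x : G ⟶ H) : F.comp G ⟶ F.comp H where
  app X := GSTrans.app x (F.functor.obj X)
  isSupernatural := .of_natural (fun _ => x.isSupernatural.mem _)
    (fun f => GSTrans.naturality x (F.functor.map f))

/-- The strict 2-category of graded `(Q, Π)`-supercategories, graded superfunctors and even
supernatural transformations of degree zero. -/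
instance : Bicategory (QPSupercat.{w, v, u} k) where
  Hom A B := GSFunctor A B
  homCategory A B := inferInstanceAs (Category (GSFunctor A B))
  id A := GSFunctor.id A
  comp F G := GSFunctor.comp F G
  whiskerLeft F _ _ x := GSTrans.precomp F x
  whiskerRight x H := GSTrans.postcomp x H
  associator F G H := Iso.refl (GSFunctor.comp F (GSFunctor.comp G H))
  leftUnitor F := Iso.refl F
  rightUnitor F := Iso.refl F
  whisker_exchange x y := by
    apply GSTrans.hom_ext
    intro X
    exact (GSTrans.naturality y (GSTrans.app x X)).symm
  whiskerLeft_id _ _ := rfl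
  whiskerLeft_comp _ _ _ _ _ _ := rfl
  id_whiskerLeft x := by
    apply GSTrans.hom_ext; intro X
    exact ((Category.id_comp _).trans (Category.comp_id _)).symm
  comp_whiskerLeft F G _ _ x := by
    apply GSTrans.hom_ext; intro X
    exact ((Category.id_comp _).trans (Category.comp_id _)).symm
  id_whiskerRight _ G := by
    apply GSTrans.hom_ext; intro X
    exact G.functor.map_id _
  comp_whiskerRight x y H := by
    apply GSTrans.hom_ext; intro X
    exact H.functor.map_comp _ _
  whiskerRight_id x := by
    apply GSTrans.hom_ext; intro X
    exact ((Category.id_comp _).trans (Category.comp_id _)).symm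
  whiskerRight_comp x G H := by
    apply GSTrans.hom_ext; intro X
    exact ((Category.id_comp _).trans (Category.comp_id _)).symm
  whisker_assoc F _ _ x H := by
    apply GSTrans.hom_ext; intro X
    exact ((Category.id_comp _).trans (Category.comp_id _)).symm
  pentagon F G H K := by
    apply GSTrans.hom_ext; intro X
    change K.functor.map (𝟙 _) ≫ 𝟙 _ ≫ 𝟙 _ = 𝟙 _ ≫ 𝟙 _
    simp
  triangle F G := by
    apply GSTrans.hom_ext; intro X
    change 𝟙 _ ≫ 𝟙 _ = G.functor.map (𝟙 _)
    simp

instance : Bicategory.Strict (QPSupercat.{w, v, u} k) where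
  id_comp _ := rfl
  comp_id _ := rfl
  assoc _ _ _ := rfl
  leftUnitor_eqToIso _ := rfl
  rightUnitor_eqToIso _ := rfl
  associator_eqToIso _ _ _ := rfl

end Supercat

/-! ## The 2-category of `(Q, Π)`-categories -/

/-- A `(Q, Π)`-category. The adjoint pair of autoequivalences `(Q, Q⁻¹)` with unit `ı⁻¹` and
counit `ȷ` is the equivalence `Q`, so `ı = Q.unitIso.symm` and `ȷ = Q.counitIso`. -/
structure QPCat (k : Type w) [CommRing k] where
  carrier : Type u
  [cat : Category.{v} carrier]
  [preadditive : Preadditive carrier]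
  [linear : Linear k carrier]
  P : carrier ⥤ carrier
  P_additive : P.Additive
  P_linear : P.Linear k
  /-- `ξ : Π² ⇒ I` -/
  ξ : P ⋙ P ≅ 𝟭 carrier
  /-- `ξ Π = Π ξ` -/
  ξ_comm : ∀ X, ξ.hom.app (P.obj X) = P.map (ξ.hom.app X)
  Q : carrier ≌ carrier
  Q_additive : Q.functor.Additive
  Q_linear : Q.functor.Linear k
  /-- `β_Q : Π Q ⇒ Q Π` -/
  βQ : Q.functor ⋙ P ≅ P ⋙ Q.functor
  /-- `ξ Q ξ⁻¹ = β_Q Π ∘ Π β_Q` -/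
  βQ_ξ : ∀ X, ξ.hom.app (Q.functor.obj X) ≫ Q.functor.map (ξ.inv.app X) =
    P.map (βQ.hom.app X) ≫ βQ.hom.app (P.obj X)

attribute [instance] QPCat.cat QPCat.preadditive QPCat.linear

/-- A `(Q, Π)`-functor. -/
structure QPFunctor {k : Type w} [CommRing k] (A B : QPCat.{w, v, u} k) where
  functor : A.carrier ⥤ B.carrier
  additive : functor.Additive
  linear : functor.Linear k
  /-- `β_F : Π' F ⇒ F Π` -/
  β : functor ⋙ B.P ≅ A.P ⋙ functor
  /-- `γ_F : Q' F ⇒ F Q` -/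
  γ : functor ⋙ B.Q.functor ≅ A.Q.functor ⋙ functor
  /-- `ξ' F ξ⁻¹ = β_F Π ∘ Π' β_F` -/
  β_ξ : ∀ X, B.ξ.hom.app (functor.obj X) ≫ functor.map (A.ξ.inv.app X) =
    B.P.map (β.hom.app X) ≫ β.hom.app (A.P.obj X)
  /-- `F β_Q ∘ β_F Q ∘ Π' γ_F = γ_F Π ∘ Q' β_F ∘ β_{Q'} F`, i.e. `γ_F : Q' F ⇒ F Q` is
  compatible with the isomorphisms `β` of `Q' F` and `F Q`. -/
  β_γ : ∀ X, B.P.map (γ.hom.app X) ≫ β.hom.app (A.Q.functor.obj X) ≫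
      functor.map (A.βQ.hom.app X) =
    B.βQ.hom.app (functor.obj X) ≫ B.Q.functor.map (β.hom.app X) ≫ γ.hom.app (A.P.obj X)

/-- A `(Q, Π)`-natural transformation. -/
@[ext]
structure QPTrans {k : Type w} [CommRing k] {A B : QPCat.{w, v, u} k} (F G : QPFunctor A B) where
  trans : F.functor ⟶ G.functor
  /-- `x Π ∘ β_F = β_G ∘ Π' x` -/
  comm_β : ∀ X, F.β.hom.app X ≫ trans.app (A.P.obj X) =
    B.P.map (trans.app X) ≫ G.β.hom.app X
  /-- `x Q ∘ γ_F = γ_G ∘ Q' x` -/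
  comm_γ : ∀ X, F.γ.hom.app X ≫ trans.app (A.Q.functor.obj X) =
    B.Q.functor.map (trans.app X) ≫ G.γ.hom.app X

section Cat

variable {k : Type w} [CommRing k]

instance (A B : QPCat.{w, v, u} k) : Category (QPFunctor A B) where
  Hom F G := QPTrans F G
  id F := { trans := 𝟙 _, comm_β := by simp, comm_γ := by simp }
  comp x y :=
    { trans := x.trans ≫ y.trans
      comm_β := fun X => by
        rw [NatTrans.comp_app, ← Category.assoc, x.comm_β, Category.assoc, y.comm_β]; simp
      comm_γ := fun X => by
        rw [NatTrans.comp_app, ← Category.assoc, x.comm_γ, Category.assoc, y.comm_γ]; simp }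
  id_comp x := QPTrans.ext (Category.id_comp _)
  comp_id x := QPTrans.ext (Category.comp_id _)
  assoc x y z := QPTrans.ext (Category.assoc _ _ _)

@[ext]
lemma QPTrans.hom_ext {A B : QPCat.{w, v, u} k} {F G : QPFunctor A B} {x y : F ⟶ G}
    (h : ∀ X, (QPTrans.trans x).app X = (QPTrans.trans y).app X) : x = y :=
  QPTrans.ext (NatTrans.ext (funext h))

@[simp] lemma QPTrans.id_trans {A B : QPCat.{w, v, u} k} (F : QPFunctor A B) :
    QPTrans.trans (𝟙 F) = 𝟙 F.functor := rfl

@[simp] lemma QPTrans.comp_trans {A B : QPCat.{w, v, u} k} {F G H : QPFunctor A B}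
    (x : F ⟶ G) (y : G ⟶ H) :
    QPTrans.trans (x ≫ y) = QPTrans.trans x ≫ QPTrans.trans y := rfl

/-- The identity `(Q, Π)`-functor: `β_I = 1`, `γ_I = 1`. -/
def QPFunctor.id (A : QPCat.{w, v, u} k) : QPFunctor A A where
  functor := 𝟭 _
  additive := inferInstance
  linear := inferInstance
  β := Iso.refl A.P
  γ := Iso.refl A.Q.functor
  β_ξ X := by simp
  β_γ X := by simp

/-- Composition of `(Q, Π)`-functors, in diagrammatic order:
`β_{GF} = G β_F ∘ β_G F` and `γ_{GF} = G γ_F ∘ γ_G F`. -/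
def QPFunctor.comp {A B C : QPCat.{w, v, u} k} (F : QPFunctor A B) (G : QPFunctor B C) :
    QPFunctor A C where
  functor := F.functor ⋙ G.functor
  additive := by have := F.additive; have := G.additive; infer_instance
  linear := by have := F.linear; have := G.linear; infer_instance
  β := NatIso.ofComponents
    (fun X => G.β.app (F.functor.obj X) ≪≫ G.functor.mapIso (F.β.app X))
    (fun {X Y} f => by
      have h1 := G.β.hom.naturality (F.functor.map f)
      have h2 := congrArg G.functor.map (F.β.hom.naturality f)
      simp only [Functor.comp_obj, Functor.comp_map, Functor.map_comp] at h1 h2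
      simp only [Functor.comp_obj, Functor.comp_map, Iso.trans_hom, Iso.app_hom,
        Functor.mapIso_hom, Category.assoc]
      rw [← Category.assoc, h1, Category.assoc, h2])
  γ := NatIso.ofComponents
    (fun X => G.γ.app (F.functor.obj X) ≪≫ G.functor.mapIso (F.γ.app X))
    (fun {X Y} f => by
      have h1 := G.γ.hom.naturality (F.functor.map f)
      have h2 := congrArg G.functor.map (F.γ.hom.naturality f)
      simp only [Functor.comp_obj, Functor.comp_map, Functor.map_comp] at h1 h2
      simp only [Functor.comp_obj, Functor.comp_map, Iso.trans_hom, Iso.app_hom,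
        Functor.mapIso_hom, Category.assoc]
      rw [← Category.assoc, h1, Category.assoc, h2])
  β_ξ X := by
    have h1 := G.β_ξ (F.functor.obj X)
    have h2 := congrArg G.functor.map (F.β_ξ X)
    have h3 := G.β.hom.naturality (F.β.hom.app X)
    simp only [Functor.comp_obj, Functor.comp_map, Functor.map_comp] at h1 h2 h3
    simp only [Functor.comp_obj, Functor.comp_map, NatIso.ofComponents_hom_app, Iso.trans_hom,
      Iso.app_hom, Functor.mapIso_hom, Category.assoc, Functor.map_comp]
    rw [reassoc_of% h3, ← h2, ← reassoc_of% h1, ← Functor.map_comp_assoc]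
    simp
  β_γ X := by
    have h1 := G.β_γ (F.functor.obj X)
    have h2 := congrArg G.functor.map (F.β_γ X)
    have h3 := G.β.hom.naturality (F.γ.hom.app X)
    have h4 := G.γ.hom.naturality (F.β.hom.app X)
    simp only [Functor.comp_obj, Functor.comp_map, Functor.map_comp] at h1 h2 h3 h4
    simp only [Functor.comp_obj, Functor.comp_map, NatIso.ofComponents_hom_app, Iso.trans_hom,
      Iso.app_hom, Functor.mapIso_hom, Category.assoc, Functor.map_comp]
    rw [reassoc_of% h3, h2, reassoc_of% h1, reassoc_of% h4]

/-- `Gx` for a `(Q, Π)`-functor `G` and a `(Q, Π)`-natural transformation `x`. -/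
def QPTrans.postcomp {A B C : QPCat.{w, v, u} k} {F G : QPFunctor A B} (x : F ⟶ G)
    (H : QPFunctor B C) : F.comp H ⟶ G.comp H where
  trans := Functor.whiskerRight (QPTrans.trans x) H.functor
  comm_β X := by
    have h1 := congrArg H.functor.map (QPTrans.comm_β x X)
    have h2 := H.β.hom.naturality ((QPTrans.trans x).app X)
    simp only [Functor.comp_obj, Functor.comp_map, Functor.map_comp] at h1 h2
    simp [QPFunctor.comp, h1, reassoc_of% h2]
  comm_γ X := by
    have h1 := congrArg H.functor.map (QPTrans.comm_γ x X)
    have h2 := H.γ.hom.naturality ((QPTrans.trans x).app X)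
    simp only [Functor.comp_obj, Functor.comp_map, Functor.map_comp] at h1 h2
    simp [QPFunctor.comp, h1, reassoc_of% h2]

/-- `xF` for a `(Q, Π)`-functor `F` and a `(Q, Π)`-natural transformation `x`. -/
def QPTrans.precomp {A B C : QPCat.{w, v, u} k} (F : QPFunctor A B)
    {G H : QPFunctor B C} (x : G ⟶ H) : F.comp G ⟶ F.comp H where
  trans := Functor.whiskerLeft F.functor (QPTrans.trans x)
  comm_β X := by
    have h1 := QPTrans.comm_β x (F.functor.obj X)
    have h2 := (QPTrans.trans x).naturality (F.β.hom.app X)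
    simp only [Functor.comp_obj] at h1 h2
    simp [QPFunctor.comp, ← reassoc_of% h1, h2]
  comm_γ X := by
    have h1 := QPTrans.comm_γ x (F.functor.obj X)
    have h2 := (QPTrans.trans x).naturality (F.γ.hom.app X)
    simp only [Functor.comp_obj] at h1 h2
    simp [QPFunctor.comp, ← reassoc_of% h1, h2]

/-- The associator, with identity components. -/
def QPFunctor.associator {A B C D : QPCat.{w, v, u} k} (F : QPFunctor A B) (G : QPFunctor B C)
    (H : QPFunctor C D) : (F.comp G).comp H ≅ F.comp (G.comp H) where
  hom :=
    { trans := (Functor.associator _ _ _).hom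
      comm_β := fun X => by simp [QPFunctor.comp]
      comm_γ := fun X => by simp [QPFunctor.comp] }
  inv :=
    { trans := (Functor.associator _ _ _).inv
      comm_β := fun X => by simp [QPFunctor.comp]
      comm_γ := fun X => by simp [QPFunctor.comp] }
  hom_inv_id := QPTrans.ext (Functor.associator _ _ _).hom_inv_id
  inv_hom_id := QPTrans.ext (Functor.associator _ _ _).inv_hom_id

/-- The left unitor, with identity components. -/
def QPFunctor.leftUnitor {A B : QPCat.{w, v, u} k} (F : QPFunctor A B) :
    (QPFunctor.id A).comp F ≅ F where
  hom :=
    { trans := F.functor.leftUnitor.hom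
      comm_β := fun X => by simp [QPFunctor.comp, QPFunctor.id]
      comm_γ := fun X => by simp [QPFunctor.comp, QPFunctor.id] }
  inv :=
    { trans := F.functor.leftUnitor.inv
      comm_β := fun X => by simp [QPFunctor.comp, QPFunctor.id]
      comm_γ := fun X => by simp [QPFunctor.comp, QPFunctor.id] }
  hom_inv_id := QPTrans.ext F.functor.leftUnitor.hom_inv_id
  inv_hom_id := QPTrans.ext F.functor.leftUnitor.inv_hom_id

/-- The right unitor, with identity components. -/
def QPFunctor.rightUnitor {A B : QPCat.{w, v, u} k} (F : QPFunctor A B) :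
    F.comp (QPFunctor.id B) ≅ F where
  hom :=
    { trans := F.functor.rightUnitor.hom
      comm_β := fun X => by simp [QPFunctor.comp, QPFunctor.id]
      comm_γ := fun X => by simp [QPFunctor.comp, QPFunctor.id] }
  inv :=
    { trans := F.functor.rightUnitor.inv
      comm_β := fun X => by simp [QPFunctor.comp, QPFunctor.id]
      comm_γ := fun X => by simp [QPFunctor.comp, QPFunctor.id] }
  hom_inv_id := QPTrans.ext F.functor.rightUnitor.hom_inv_id
  inv_hom_id := QPTrans.ext F.functor.rightUnitor.inv_hom_id

/-- The strict 2-category of `(Q, Π)`-categories, `(Q, Π)`-functors and `(Q, Π)`-natural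
transformations. -/
instance : Bicategory (QPCat.{w, v, u} k) where
  Hom A B := QPFunctor A B
  homCategory A B := inferInstanceAs (Category (QPFunctor A B))
  id A := QPFunctor.id A
  comp F G := QPFunctor.comp F G
  whiskerLeft F _ _ x := QPTrans.precomp F x
  whiskerRight x H := QPTrans.postcomp x H
  associator F G H := QPFunctor.associator F G H
  leftUnitor F := QPFunctor.leftUnitor F
  rightUnitor F := QPFunctor.rightUnitor F
  whisker_exchange x y := by
    apply QPTrans.hom_ext
    intro X
    exact ((QPTrans.trans y).naturality ((QPTrans.trans x).app X)).symm
  whiskerLeft_id _ _ := rfl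
  whiskerLeft_comp _ _ _ _ _ _ := rfl
  id_whiskerLeft x := by
    apply QPTrans.hom_ext; intro X
    exact ((Category.id_comp _).trans (Category.comp_id _)).symm
  comp_whiskerLeft F G _ _ x := by
    apply QPTrans.hom_ext; intro X
    exact ((Category.id_comp _).trans (Category.comp_id _)).symm
  id_whiskerRight _ G := by
    apply QPTrans.hom_ext; intro X
    exact G.functor.map_id _
  comp_whiskerRight x y H := by
    apply QPTrans.hom_ext; intro X
    exact H.functor.map_comp _ _
  whiskerRight_id x := by
    apply QPTrans.hom_ext; intro X
    exact ((Category.id_comp _).trans (Category.comp_id _)).symm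
  whiskerRight_comp x G H := by
    apply QPTrans.hom_ext; intro X
    exact ((Category.id_comp _).trans (Category.comp_id _)).symm
  whisker_assoc F _ _ x H := by
    apply QPTrans.hom_ext; intro X
    exact ((Category.id_comp _).trans (Category.comp_id _)).symm
  pentagon F G H K := by
    apply QPTrans.hom_ext; intro X
    change K.functor.map (𝟙 _) ≫ 𝟙 _ ≫ 𝟙 _ = 𝟙 _ ≫ 𝟙 _
    simp
  triangle F G := by
    apply QPTrans.hom_ext; intro X
    change 𝟙 _ ≫ 𝟙 _ = G.functor.map (𝟙 _)
    simp

lemma QPFunctor.ext_of_app {A B : QPCat.{w, v, u} k} {F G : QPFunctor A B}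
    (h : F.functor = G.functor)
    (hβ : ∀ X, F.β.hom.app X ≫ eqToHom (by rw [h]) =
      B.P.map (eqToHom (by rw [h])) ≫ G.β.hom.app X)
    (hγ : ∀ X, F.γ.hom.app X ≫ eqToHom (by rw [h]) =
      B.Q.functor.map (eqToHom (by rw [h])) ≫ G.γ.hom.app X) : F = G := by
  obtain ⟨F, _, _, β, γ, _, _⟩ := F
  obtain ⟨G, _, _, β', γ', _, _⟩ := G
  obtain rfl : F = G := h
  obtain rfl : β = β' := by ext X; simpa using hβ X
  obtain rfl : γ = γ' := by ext X; simpa using hγ X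
  rfl

lemma QPFunctor.ext_of_heq {A B : QPCat.{w, v, u} k} {F G : QPFunctor A B}
    (h : F.functor = G.functor) (hβ : ∀ X, F.β.hom.app X ≍ G.β.hom.app X)
    (hγ : ∀ X, F.γ.hom.app X ≍ G.γ.hom.app X) : F = G := by
  obtain ⟨F, _, _, β, γ, _, _⟩ := F
  obtain ⟨G, _, _, β', γ', _, _⟩ := G
  obtain rfl : F = G := h
  obtain rfl : β = β' := by ext X; exact eq_of_heq (hβ X)
  obtain rfl : γ = γ' := by ext X; exact eq_of_heq (hγ X)
  rfl

lemma QPFunctor.ext_of_iso {A B : QPCat.{w, v, u} k} {F G : QPFunctor A B} (e : F ≅ G)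
    (h : F.functor = G.functor)
    (he : ∀ X, (QPTrans.trans e.hom).app X = eqToHom (by rw [h])) : F = G := by
  have hβ := QPTrans.comm_β e.hom
  have hγ := QPTrans.comm_γ e.hom
  simp only [he] at hβ hγ
  exact QPFunctor.ext_of_app h hβ hγ

lemma QPTrans.eqToHom_app {A B : QPCat.{w, v, u} k} {F G : QPFunctor A B} (h : F = G) (X) :
    (QPTrans.trans (eqToHom h)).app X = eqToHom (by rw [h]) := by
  subst h; rfl

instance : Bicategory.Strict (QPCat.{w, v, u} k) where
  id_comp F := QPFunctor.ext_of_iso (QPFunctor.leftUnitor F) rfl (fun _ => rfl)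
  comp_id F := QPFunctor.ext_of_iso (QPFunctor.rightUnitor F) rfl (fun _ => rfl)
  assoc F G H := QPFunctor.ext_of_iso (QPFunctor.associator F G H) rfl (fun _ => rfl)
  leftUnitor_eqToIso F := Iso.ext <| QPTrans.hom_ext fun X =>
    (QPTrans.eqToHom_app (QPFunctor.ext_of_iso (QPFunctor.leftUnitor F) rfl (fun _ => rfl)) X).symm
  rightUnitor_eqToIso F := Iso.ext <| QPTrans.hom_ext fun X =>
    (QPTrans.eqToHom_app (QPFunctor.ext_of_iso (QPFunctor.rightUnitor F) rfl (fun _ => rfl)) X).symm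
  associator_eqToIso F G H := Iso.ext <| QPTrans.hom_ext fun X =>
    (QPTrans.eqToHom_app
      (QPFunctor.ext_of_iso (QPFunctor.associator F G H) rfl (fun _ => rfl)) X).symm

end Cat

/-! ## The 2-functor `E` -/

section E

variable {k : Type w} [CommRing k]

section Object

variable (A : QPSupercat.{w, v, u} k)

lemma zmod_val_one : (1 : ZMod 2).val = 1 := rfl

lemma map_ζ {X Y : A.carrier} {n : ℤ} {p : ZMod 2} {f : X ⟶ Y} (hf : f ∈ homog k X Y (n, p)) :
    A.P.map f ≫ (A.ζ Y).hom = (-1 : ℤ) ^ p.val • ((A.ζ X).hom ≫ f) := by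
  simpa [zmod_val_one] using A.hζ.comm hf

lemma map_ζ_even {X Y : A.carrier} {f : X ⟶ Y} (hf : f ∈ homog k X Y 0) :
    A.P.map f ≫ (A.ζ Y).hom = (A.ζ X).hom ≫ f := by
  simpa using map_ζ A (n := 0) (p := 0) hf

lemma map_ζ_odd {X Y : A.carrier} {n : ℤ} {f : X ⟶ Y} (hf : f ∈ homog k X Y (n, 1)) :
    A.P.map f ≫ (A.ζ Y).hom = -((A.ζ X).hom ≫ f) := by
  simpa [zmod_val_one] using map_ζ A hf

/-- An even supernatural transformation of any degree is natural for all morphisms. -/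
lemma map_σ {X Y : A.carrier} (f : X ⟶ Y) :
    A.Q.map f ≫ (A.σ Y).hom = (A.σ X).hom ≫ f := by
  have := A.hQ.additive
  refine hom_induction (k := k)
    (P := fun f => A.Q.map f ≫ (A.σ Y).hom = (A.σ X).hom ≫ f) ?_
    (fun f g hf hg => ?_) (fun i f hf => ?_) f
  · simp
  · simp [hf, hg]
  · simpa using A.hσ.comm (m := i.1) (q := i.2) hf

lemma map_σ' {X Y : A.carrier} (f : X ⟶ Y) :
    A.Qinv.map f ≫ (A.σ' Y).hom = (A.σ' X).hom ≫ f := by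
  have := A.hQinv.additive
  refine hom_induction (k := k)
    (P := fun f => A.Qinv.map f ≫ (A.σ' Y).hom = (A.σ' X).hom ≫ f) ?_
    (fun f g hf hg => ?_) (fun i f hf => ?_) f
  · simp
  · simp [hf, hg]
  · simpa using A.hσ'.comm (m := i.1) (q := i.2) hf

lemma map_σ_assoc {X Y Z : A.carrier} (f : X ⟶ Y) (g : Y ⟶ Z) :
    A.Q.map f ≫ (A.σ Y).hom ≫ g = (A.σ X).hom ≫ f ≫ g := by
  rw [← Category.assoc, map_σ, Category.assoc]

lemma map_σ'_assoc {X Y Z : A.carrier} (f : X ⟶ Y) (g : Y ⟶ Z) :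
    A.Qinv.map f ≫ (A.σ' Y).hom ≫ g = (A.σ' X).hom ≫ f ≫ g := by
  rw [← Category.assoc, map_σ', Category.assoc]

/-- `ξ := ζ ζ : Π² ⇒ I`, the horizontal composite `ξ_X = ζ_X ∘ Π ζ_X`. -/
def xiIso (X : A.carrier) : A.P.obj (A.P.obj X) ≅ X :=
  A.P.mapIso (A.ζ X) ≪≫ A.ζ X

/-- `ı := σ' σ : Q⁻¹ Q ⇒ I`, the horizontal composite `ı_X = σ'_X ∘ Q⁻¹ σ_X`. -/
def iIso (X : A.carrier) : A.Qinv.obj (A.Q.obj X) ≅ X :=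
  A.Qinv.mapIso (A.σ X) ≪≫ A.σ' X

/-- `ȷ := σ σ' : Q Q⁻¹ ⇒ I`, the horizontal composite `ȷ_X = σ_X ∘ Q σ'_X`. -/
def jIso (X : A.carrier) : A.Q.obj (A.Qinv.obj X) ≅ X :=
  A.Q.mapIso (A.σ' X) ≪≫ A.σ X

lemma xiIso_mem (X : A.carrier) : (xiIso A X).hom ∈ homog k (A.P.obj (A.P.obj X)) X 0 :=
  GradedSupercategory.comp_mem (A.hP.map_mem (A.hζ.mem X)) (A.hζ.mem X)

lemma iIso_mem (X : A.carrier) : (iIso A X).hom ∈ homog k (A.Qinv.obj (A.Q.obj X)) X 0 :=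
  GradedSupercategory.comp_mem (A.hQinv.map_mem (A.hσ.mem X)) (A.hσ'.mem X)

lemma jIso_mem (X : A.carrier) : (jIso A X).hom ∈ homog k (A.Q.obj (A.Qinv.obj X)) X 0 :=
  GradedSupercategory.comp_mem (A.hQ.map_mem (A.hσ'.mem X)) (A.hσ.mem X)

end Object

section Functor

lemma P_map_ζ (A : QPSupercat.{w, v, u} k) (X : A.carrier) :
    A.P.map (A.ζ X).hom = -(A.ζ (A.P.obj X)).hom := by
  have h : A.P.map (A.ζ X).hom ≫ (A.ζ X).hom = -((A.ζ (A.P.obj X)).hom ≫ (A.ζ X).hom) :=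
    map_ζ_odd A (A.hζ.mem X)
  rw [← cancel_mono (A.ζ X).hom, h]
  simp

lemma P_map_ζ_inv (A : QPSupercat.{w, v, u} k) (X : A.carrier) :
    A.P.map (A.ζ X).inv = -(A.ζ (A.P.obj X)).inv := by
  rw [← cancel_mono (A.P.map (A.ζ X).hom), ← A.P.map_comp, P_map_ζ]
  simp

variable {A B : QPSupercat.{w, v, u} k}

/-- `β_F := -ζ' F ζ⁻¹ : Π' F ⇒ F Π` (horizontal composite). -/
def betaIso (F : A.carrier ⥤ B.carrier) (X : A.carrier) :
    B.P.obj (F.obj X) ≅ F.obj (A.P.obj X) :=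
  -(B.P.mapIso (F.mapIso (A.ζ X).symm) ≪≫ B.ζ (F.obj (A.P.obj X)))

/-- `γ_F := σ' F σ⁻¹ : Q' F ⇒ F Q` (horizontal composite). -/
def gammaIso (F : A.carrier ⥤ B.carrier) (X : A.carrier) :
    B.Q.obj (F.obj X) ≅ F.obj (A.Q.obj X) :=
  B.Q.mapIso (F.mapIso (A.σ X).symm) ≪≫ B.σ (F.obj (A.Q.obj X))

variable {F : A.carrier ⥤ B.carrier}

lemma betaIso_mem (hF : IsGradedSuperfunctor k F) (X : A.carrier) : (betaIso F X).hom ∈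
    homog k (B.P.obj (F.obj X)) (F.obj (A.P.obj X)) 0 :=
  Submodule.neg_mem _ (GradedSupercategory.comp_mem (i := (0, 1)) (j := (0, 1))
    (B.hP.map_mem (hF.map_mem (inv_mem (A.ζ X) (A.hζ.mem X)))) (B.hζ.mem _))

lemma gammaIso_mem (hF : IsGradedSuperfunctor k F) (X : A.carrier) : (gammaIso F X).hom ∈
    homog k (B.Q.obj (F.obj X)) (F.obj (A.Q.obj X)) 0 :=
  GradedSupercategory.comp_mem (i := (1, 0)) (j := (-1, 0))
    (B.hQ.map_mem (hF.map_mem (inv_mem (A.σ X) (A.hσ.mem X)))) (B.hσ.mem _)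

lemma betaIso_hom (hF : IsGradedSuperfunctor k F) (X : A.carrier) :
    (betaIso F X).hom = (B.ζ (F.obj X)).hom ≫ F.map (A.ζ X).inv := by
  have h := map_ζ_odd B (n := 0) (hF.map_mem (i := (0, 1)) (inv_mem (A.ζ X) (A.hζ.mem X)))
  simp [betaIso, h]

lemma gammaIso_hom (X : A.carrier) :
    (gammaIso F X).hom = (B.σ (F.obj X)).hom ≫ F.map (A.σ X).inv := by
  simp [gammaIso, map_σ]

lemma betaIso_natural (hF : IsGradedSuperfunctor k F) {X Y : A.carrier} {f : X ⟶ Y} (hf : f ∈ homog k X Y 0) :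
    B.P.map (F.map f) ≫ (betaIso F Y).hom = (betaIso F X).hom ≫ F.map (A.P.map f) := by
  have h1 := map_ζ_even B (hF.map_mem hf)
  have h2 : f ≫ (A.ζ Y).inv = (A.ζ X).inv ≫ A.P.map f := by
    rw [Iso.comp_inv_eq, Category.assoc, map_ζ_even A hf, Iso.inv_hom_id_assoc]
  rw [betaIso_hom hF, betaIso_hom hF, reassoc_of% h1, ← F.map_comp, h2, F.map_comp,
    Category.assoc]

lemma gammaIso_natural {X Y : A.carrier} (f : X ⟶ Y) :
    B.Q.map (F.map f) ≫ (gammaIso F Y).hom = (gammaIso F X).hom ≫ F.map (A.Q.map f) := by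
  have h2 : f ≫ (A.σ Y).inv = (A.σ X).inv ≫ A.Q.map f := by
    rw [Iso.comp_inv_eq, Category.assoc, map_σ, Iso.inv_hom_id_assoc]
  rw [gammaIso_hom, gammaIso_hom, map_σ_assoc, ← F.map_comp, h2, F.map_comp,
    Category.assoc]

lemma beta_xi (hF : IsGradedSuperfunctor k F) (X : A.carrier) :
    (xiIso B (F.obj X)).hom ≫ F.map (xiIso A X).inv =
      B.P.map (betaIso F X).hom ≫ (betaIso F (A.P.obj X)).hom := by
  have h1 := map_ζ_even B (betaIso_mem hF X)
  have hadd := hF.additive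
  rw [betaIso_hom hF (A.P.obj X), reassoc_of% h1, betaIso_hom hF X]
  simp [xiIso, P_map_ζ, P_map_ζ_inv]

lemma beta_gamma (hF : IsGradedSuperfunctor k F) (X : A.carrier) :
    B.P.map (gammaIso F X).hom ≫ (betaIso F (A.Q.obj X)).hom ≫
        F.map (betaIso A.Q X).hom =
      (betaIso B.Q (F.obj X)).hom ≫ B.Q.map (betaIso F X).hom ≫
        (gammaIso F (A.P.obj X)).hom := by
  have h1 := map_ζ_even B (gammaIso_mem hF X)
  have h2 : (A.σ X).inv ≫ A.Q.map (A.ζ X).inv = (A.ζ X).inv ≫ (A.σ (A.P.obj X)).inv := by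
    rw [Iso.inv_comp_eq, ← Category.assoc, Iso.eq_comp_inv, map_σ]
  rw [betaIso_hom hF (A.Q.obj X), Category.assoc, reassoc_of% h1, gammaIso_hom X,
    betaIso_hom A.hQ, betaIso_hom B.hQ, gammaIso_hom (A.P.obj X), map_σ_assoc,
    betaIso_hom hF X]
  simp only [Functor.map_comp, Category.assoc]
  rw [← map_σ_assoc B (B.ζ (F.obj X)).hom, ← B.Q.map_comp_assoc, Iso.inv_hom_id,
    B.Q.map_id, Category.id_comp,
    ← F.map_comp_assoc (A.ζ (A.Q.obj X)).inv, Iso.inv_hom_id, F.map_id, Category.id_comp,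
    ← F.map_comp, h2, F.map_comp]

lemma betaIso_comp {C : QPSupercat.{w, v, u} k} {F : A.carrier ⥤ B.carrier}
    {G : B.carrier ⥤ C.carrier} (hF : IsGradedSuperfunctor k F)
    (hG : IsGradedSuperfunctor k G) (X : A.carrier) :
    (betaIso (F ⋙ G) X).hom = (betaIso G (F.obj X)).hom ≫ G.map (betaIso F X).hom := by
  have h : IsGradedSuperfunctor k (F ⋙ G) := (GSFunctor.comp ⟨F, hF⟩ ⟨G, hG⟩).isSuper
  rw [betaIso_hom h, betaIso_hom hF, betaIso_hom hG]
  simp [← Functor.map_comp]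

lemma gammaIso_comp {C : QPSupercat.{w, v, u} k} {F : A.carrier ⥤ B.carrier}
    {G : B.carrier ⥤ C.carrier} (X : A.carrier) :
    (gammaIso (F ⋙ G) X).hom = (gammaIso G (F.obj X)).hom ≫ G.map (gammaIso F X).hom := by
  rw [gammaIso_hom, gammaIso_hom, gammaIso_hom]
  simp [← Functor.map_comp]

end Functor

section Object

variable (A : QPSupercat.{w, v, u} k)

lemma xi_natural {X Y : A.carrier} {f : X ⟶ Y} (hf : f ∈ homog k X Y 0) :
    A.P.map (A.P.map f) ≫ (xiIso A Y).hom = (xiIso A X).hom ≫ f := by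
  have h1 := map_ζ_even A hf
  have h2 := map_ζ_even A (A.hP.map_mem hf)
  simp [xiIso, P_map_ζ, h1, reassoc_of% h2]

lemma i_natural {X Y : A.carrier} (f : X ⟶ Y) :
    A.Qinv.map (A.Q.map f) ≫ (iIso A Y).hom = (iIso A X).hom ≫ f := by
  simp only [iIso, Iso.trans_hom, Functor.mapIso_hom, map_σ', map_σ'_assoc, map_σ, Category.assoc]

lemma j_natural {X Y : A.carrier} (f : X ⟶ Y) :
    A.Q.map (A.Qinv.map f) ≫ (jIso A Y).hom = (jIso A X).hom ≫ f := by
  simp only [jIso, Iso.trans_hom, Functor.mapIso_hom, map_σ', map_σ_assoc, map_σ, Category.assoc]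

lemma xi_comm (X : A.carrier) : (xiIso A (A.P.obj X)).hom = A.P.map (xiIso A X).hom := by
  have := A.hP.additive
  simp [xiIso, P_map_ζ]

lemma i_j (X : A.carrier) :
    A.Q.map (iIso A X).inv ≫ (jIso A (A.Q.obj X)).hom = 𝟙 (A.Q.obj X) := by
  have h : (jIso A (A.Q.obj X)).hom = A.Q.map (iIso A X).hom := by
    rw [← cancel_mono (A.σ X).hom, map_σ]
    simp [jIso, iIso, map_σ, map_σ']
  rw [h, ← A.Q.map_comp, Iso.inv_hom_id, A.Q.map_id]

end Object

/-- The `(Q, Π)`-category underlying a graded `(Q, Π)`-supercategory. -/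
def E.obj (A : QPSupercat.{w, v, u} k) : QPCat.{w, v, u} k where
  carrier := Underlying k A.carrier
  P := Underlying.functor A.P A.hP
  P_additive := Underlying.functor_additive A.P A.hP
  P_linear := Underlying.functor_linear A.P A.hP
  ξ := NatIso.ofComponents (fun X => Underlying.isoMk (xiIso A X.as) (xiIso_mem A X.as))
    (fun f => Underlying.hom_ext (xi_natural A (Underlying.val_mem f)))
  ξ_comm X := Underlying.hom_ext (xi_comm A X.as)
  Q :=
    { functor := Underlying.functor A.Q A.hQ
      inverse := Underlying.functor A.Qinv A.hQinv
      unitIso := (NatIso.ofComponents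
        (fun X => Underlying.isoMk (iIso A X.as) (iIso_mem A X.as))
        (fun f => Underlying.hom_ext (i_natural A (Underlying.val f))) :
          Underlying.functor A.Q A.hQ ⋙ Underlying.functor A.Qinv A.hQinv ≅
            𝟭 (Underlying k A.carrier)).symm
      counitIso := NatIso.ofComponents
        (fun X => Underlying.isoMk (jIso A X.as) (jIso_mem A X.as))
        (fun f => Underlying.hom_ext (j_natural A (Underlying.val f)))
      functor_unitIso_comp := fun X => Underlying.hom_ext (i_j A X.as) }
  Q_additive := Underlying.functor_additive A.Q A.hQ
  Q_linear := Underlying.functor_linear A.Q A.hQ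
  βQ := NatIso.ofComponents
    (fun X => Underlying.isoMk (betaIso A.Q X.as) (betaIso_mem A.hQ X.as))
    (fun f => Underlying.hom_ext (betaIso_natural A.hQ (Underlying.val_mem f)))
  βQ_ξ X := Underlying.hom_ext (beta_xi A.hQ X.as)

/-- The `(Q, Π)`-functor underlying a graded superfunctor. -/
def E.map {A B : QPSupercat.{w, v, u} k} (F : GSFunctor A B) :
    QPFunctor (E.obj A) (E.obj B) where
  functor := Underlying.functor F.functor F.isSuper
  additive := Underlying.functor_additive F.functor F.isSuper
  linear := Underlying.functor_linear F.functor F.isSuper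
  β := NatIso.ofComponents
    (fun X => Underlying.isoMk (betaIso F.functor X.as) (betaIso_mem F.isSuper X.as))
    (fun f => Underlying.hom_ext (betaIso_natural F.isSuper (Underlying.val_mem f)))
  γ := NatIso.ofComponents
    (fun X => Underlying.isoMk (gammaIso F.functor X.as) (gammaIso_mem F.isSuper X.as))
    (fun f => Underlying.hom_ext (gammaIso_natural (Underlying.val f)))
  β_ξ X := Underlying.hom_ext (beta_xi F.isSuper X.as)
  β_γ X := Underlying.hom_ext (beta_gamma F.isSuper X.as)

/-- The `(Q, Π)`-natural transformation underlying an even supernatural transformation of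
degree zero. -/
def E.map₂ {A B : QPSupercat.{w, v, u} k} {F G : GSFunctor A B} (x : F ⟶ G) :
    E.map F ⟶ E.map G where
  trans :=
    { app := fun X => Underlying.mk (GSTrans.app x X.as) (x.isSupernatural.mem X.as)
      naturality := fun _ _ f =>
        Underlying.hom_ext (GSTrans.naturality x (Underlying.val f)) }
  comm_β X := Underlying.hom_ext (by
    change (betaIso F.functor X.as).hom ≫ GSTrans.app x (A.P.obj X.as) =
      B.P.map (GSTrans.app x X.as) ≫ (betaIso G.functor X.as).hom
    have h := map_ζ_even B (x.isSupernatural.mem X.as)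
    rw [betaIso_hom F.isSuper, betaIso_hom G.isSuper, reassoc_of% h, Category.assoc,
      GSTrans.naturality])
  comm_γ X := Underlying.hom_ext (by
    change (gammaIso F.functor X.as).hom ≫ GSTrans.app x (A.Q.obj X.as) =
      B.Q.map (GSTrans.app x X.as) ≫ (gammaIso G.functor X.as).hom
    rw [gammaIso_hom, gammaIso_hom, map_σ_assoc, Category.assoc, GSTrans.naturality])

lemma E.map_id (A : QPSupercat.{w, v, u} k) :
    E.map (GSFunctor.id A) = QPFunctor.id (E.obj A) := by
  refine QPFunctor.ext_of_heq rfl (fun X => heq_of_eq (Underlying.hom_ext ?_))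
    (fun X => heq_of_eq (Underlying.hom_ext ?_))
  · exact (betaIso_hom (GSFunctor.id A).isSuper X.as).trans (Iso.hom_inv_id _)
  · exact (gammaIso_hom X.as).trans (Iso.hom_inv_id _)

lemma E.map_comp {A B C : QPSupercat.{w, v, u} k} (F : GSFunctor A B) (G : GSFunctor B C) :
    E.map (F.comp G) = (E.map F).comp (E.map G) := by
  refine QPFunctor.ext_of_heq rfl (fun X => heq_of_eq (Underlying.hom_ext ?_))
    (fun X => heq_of_eq (Underlying.hom_ext ?_))
  · exact betaIso_comp F.isSuper G.isSuper X.as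
  · exact gammaIso_comp X.as

variable (k) in
/-- The strict 2-functor `E` from graded `(Q, Π)`-supercategories to `(Q, Π)`-categories. -/
def E : StrictPseudofunctor (QPSupercat.{w, v, u} k) (QPCat.{w, v, u} k) :=
  StrictPseudofunctor.mk''
    { obj := E.obj
      map := E.map
      map₂ := E.map₂
      map₂_id := fun _ => rfl
      map₂_comp := fun _ _ => rfl
      map_id := E.map_id
      map_comp := E.map_comp
      map₂_whisker_left := fun F G H x => by
        apply QPTrans.hom_ext; intro X
        erw [QPTrans.comp_trans, QPTrans.comp_trans, NatTrans.comp_app, NatTrans.comp_app,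
          QPTrans.eqToHom_app, QPTrans.eqToHom_app]
        exact ((Category.id_comp _).trans (Category.comp_id _)).symm
      map₂_whisker_right := fun x H => by
        apply QPTrans.hom_ext; intro X
        erw [QPTrans.comp_trans, QPTrans.comp_trans, NatTrans.comp_app, NatTrans.comp_app,
          QPTrans.eqToHom_app, QPTrans.eqToHom_app]
        exact ((Category.id_comp _).trans (Category.comp_id _)).symm }

end E

/-- A pseudofunctor is a 2-equivalence if it has an inverse up to equivalence: a pseudofunctor
`D` such that `E ∘ D` and `D ∘ E` are equivalent to the identities in the bicategories of
pseudofunctors, strong transformations and modifications. -/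
def IsTwoEquivalence {B : Type u₁} [Bicategory.{w₁, v₁} B] {C : Type u₂} [Bicategory.{w₂, v₂} C]
    (E : B ⥤ᵖ C) : Prop :=
  ∃ D : C ⥤ᵖ B, Nonempty (D.comp E ≌ Pseudofunctor.id C) ∧ Nonempty (E.comp D ≌ Pseudofunctor.id B)

end

end QPi

/-!
A strict 2-functor between strict 2-categories which is an equivalence of the underlying
1-categories and fully faithful on 2-cells is a 2-equivalence, because the inverse on 1-cells
extends to 2-cells by full faithfulness. So everything reduces to reconstructing graded
supercategories from their underlying categories.

In a graded `(Q, Π)`-supercategory an object `X` is isomorphic, through composites of `σ` and `ζ`,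
to its shifts `Q^(-n) Π^p X`, indexed by the bidegrees `(n, p)`. The matrix of a homogeneous
morphism `X ⟶ Y` of bidegree `i` in terms of these isomorphisms is a family of even morphisms of
degree zero from the `a`-th shift of `X` to the `(a + i)`-th shift of `Y`, compatible up to signs
with the action of `Q` and `Π` on the shifts, and determined by its entry at `a = 0`. Such
matrices make sense in any `(Q, Π)`-category and form the morphisms of a graded
`(Q, Π)`-supercategory `D`, so `E` is essentially surjective. A `(Q, Π)`-functor acts on matrices,
so `E` is full on 1-cells. Finally, all morphisms are generated by the even ones of
degree zero, `ζ` and `σ`, so `E` is fully faithful on 2-cells. Applied to identity 2-cells between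
functors with equal restrictions, this also gives faithfulness on 1-cells.
-/

namespace QPi

noncomputable section

/-! ## Strict 2-functors -/

section Strict

open Bicategory

/-- The 2-cells between two objects with their source and target 1-cells bundled, so that the
axioms of a strict bicategory become equations without `eqToHom`. -/
abbrev TwoCell {B : Type u₁} [Bicategory.{w₁, v₁} B] (a b : B) : Type (max w₁ v₁) := Arrow (a ⟶ b)

namespace TwoCell

variable {B : Type u₁} [Bicategory.{w₁, v₁} B] {a b c d : B}

/-- Left whiskering of bundled 2-cells. -/
def whiskerLeft (e : a ⟶ b) (x : TwoCell b c) : TwoCell a c := .mk (e ◁ x.hom)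

/-- Right whiskering of bundled 2-cells. -/
def whiskerRight (x : TwoCell a b) (e : b ⟶ c) : TwoCell a c := .mk (x.hom ▷ e)

lemma mk_eq_iff {f g f' g' : a ⟶ b} (hf : f = f') (hg : g = g') (x : f ⟶ g) (x' : f' ⟶ g') :
    (Arrow.mk x : TwoCell a b) = Arrow.mk x' ↔ x = eqToHom hf ≫ x' ≫ eqToHom hg.symm := by
  rw [Arrow.mk_eq_mk_iff, exists_prop_of_true hf, exists_prop_of_true hg]

variable [Strict B]

lemma id_whiskerLeft (x : TwoCell a b) : whiskerLeft (𝟙 a) x = x :=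
  (Arrow.mk_eq_mk_iff _ _).2 ⟨Strict.id_comp _, Strict.id_comp _, by
    simp [Strict.leftUnitor_eqToIso]⟩

lemma whiskerRight_id (x : TwoCell a b) : whiskerRight x (𝟙 b) = x :=
  (Arrow.mk_eq_mk_iff _ _).2 ⟨Strict.comp_id _, Strict.comp_id _, by
    simp [Strict.rightUnitor_eqToIso]⟩

lemma comp_whiskerLeft (e : a ⟶ b) (e' : b ⟶ c) (x : TwoCell c d) :
    whiskerLeft (e ≫ e') x = whiskerLeft e (whiskerLeft e' x) :=
  (Arrow.mk_eq_mk_iff _ _).2 ⟨Strict.assoc _ _ _, Strict.assoc _ _ _, by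
    simp [whiskerLeft, Strict.associator_eqToIso]⟩

lemma whiskerRight_comp (x : TwoCell a b) (e : b ⟶ c) (e' : c ⟶ d) :
    whiskerRight x (e ≫ e') = whiskerRight (whiskerRight x e) e' :=
  (Arrow.mk_eq_mk_iff _ _).2 ⟨(Strict.assoc _ _ _).symm, (Strict.assoc _ _ _).symm, by
    simp [whiskerRight, Strict.associator_eqToIso]⟩

lemma whisker_assoc (e : a ⟶ b) (x : TwoCell b c) (e' : c ⟶ d) :
    whiskerRight (whiskerLeft e x) e' = whiskerLeft e (whiskerRight x e') :=
  (Arrow.mk_eq_mk_iff _ _).2 ⟨Strict.assoc _ _ _, Strict.assoc _ _ _, by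
    simp [whiskerRight, whiskerLeft, Strict.associator_eqToIso]⟩

end TwoCell

variable {B : Type u₁} [Bicategory.{w₁, v₁} B] {C : Type u₂} [Bicategory.{w₂, v₂} C]

/-- The action of a 2-functor on bundled 2-cells. -/
def TwoCell.map (F : StrictPseudofunctor B C) {a b : B} (x : TwoCell a b) :
    TwoCell (F.obj a) (F.obj b) :=
  .mk (F.map₂ x.hom)

lemma TwoCell.map_whiskerLeft (F : StrictPseudofunctor B C) {a b c : B} (e : a ⟶ b)
    (x : TwoCell b c) : (whiskerLeft e x).map F = whiskerLeft (F.map e) (x.map F) :=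
  (mk_eq_iff (F.map_comp _ _) (F.map_comp _ _) _ _).2 <| by
    simp [F.map₂_whisker_left, F.mapComp_eq_eqToIso, TwoCell.map, whiskerLeft]

lemma TwoCell.map_whiskerRight (F : StrictPseudofunctor B C) {a b c : B} (x : TwoCell a b)
    (e : b ⟶ c) : (whiskerRight x e).map F = whiskerRight (x.map F) (F.map e) :=
  (mk_eq_iff (F.map_comp _ _) (F.map_comp _ _) _ _).2 <| by
    simp [F.map₂_whisker_right, F.mapComp_eq_eqToIso, TwoCell.map, whiskerRight]

/-- A natural isomorphism of strict 2-functors in the strict sense: 1-cells, strictly inverse to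
each other, that are natural on the nose. Naturality in 1-cells is the case of identity 2-cells. -/
structure StrictIso (F G : StrictPseudofunctor B C) where
  /-- The components. -/
  hom : ∀ a, F.obj a ⟶ G.obj a
  /-- The components of the inverse. -/
  inv : ∀ a, G.obj a ⟶ F.obj a
  hom_inv : ∀ a, hom a ≫ inv a = 𝟙 _
  inv_hom : ∀ a, inv a ≫ hom a = 𝟙 _
  naturality : ∀ {a b : B} (x : TwoCell a b),
    (x.map F).whiskerRight (hom b) = (x.map G).whiskerLeft (hom a)

namespace StrictIso

variable {F G : StrictPseudofunctor B C}

lemma map_comp_hom (η : StrictIso F G) {a b : B} (f : a ⟶ b) :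
    F.map f ≫ η.hom b = η.hom a ≫ G.map f :=
  congrArg Arrow.left (η.naturality (.mk (𝟙 f)))

variable [Strict B] [Strict C]

/-- The inverse of a strict natural isomorphism. -/
def symm (η : StrictIso F G) : StrictIso G F where
  hom := η.inv
  inv := η.hom
  hom_inv := η.inv_hom
  inv_hom := η.hom_inv
  naturality {a b} x := by
    rw [← (x.map G).id_whiskerLeft, ← η.inv_hom, TwoCell.comp_whiskerLeft, ← η.naturality,
      TwoCell.whisker_assoc, ← TwoCell.whiskerRight_comp, η.hom_inv, TwoCell.whiskerRight_id]

/-- The strong transformation underlying a strict natural isomorphism. -/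
def toStrongTrans (η : StrictIso F G) : F.toPseudofunctor ⟶ G.toPseudofunctor :=
  Pseudofunctor.StrongTrans.mk η.hom (fun f => eqToIso (η.map_comp_hom f))
    (fun {a b f g} x => by
      have h : F.map₂ x ▷ η.hom b = eqToHom (η.map_comp_hom f) ≫ η.hom a ◁ G.map₂ x ≫
          eqToHom (η.map_comp_hom g).symm :=
        (TwoCell.mk_eq_iff _ (η.map_comp_hom g) _ _).1 (η.naturality (.mk x))
      simp [h])
    (fun a => by
      simp [F.mapId_eq_eqToIso, G.mapId_eq_eqToIso, Strict.leftUnitor_eqToIso,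
        Strict.rightUnitor_eqToIso])
    (fun f g => by
      simp [F.mapComp_eq_eqToIso, G.mapComp_eq_eqToIso, Strict.associator_eqToIso])

lemma map_comp_hom_inv (η : StrictIso F G) {a b : B} (f : a ⟶ b) :
    F.map f ≫ η.hom b ≫ η.inv b = (η.hom a ≫ η.inv a) ≫ F.map f := by
  rw [η.hom_inv, η.hom_inv, Strict.id_comp, Strict.comp_id]

lemma toStrongTrans_comp_symm_naturality (η : StrictIso F G) {a b : B} (f : a ⟶ b) :
    ((η.toStrongTrans ≫ η.symm.toStrongTrans).naturality f).hom =
      eqToHom (η.map_comp_hom_inv f) := by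
  have inv_naturality : G.map f ≫ η.inv b = η.inv a ≫ F.map f := η.symm.map_comp_hom f
  have h : (α_ (F.map f) (η.hom b) (η.inv b)).inv ≫ eqToHom (η.map_comp_hom f) ▷ η.inv b ≫
      (α_ (η.hom a) (G.map f) (η.inv b)).hom ≫ η.hom a ◁ eqToHom inv_naturality ≫
        (α_ (η.hom a) (η.inv a) (F.map f)).inv = eqToHom (η.map_comp_hom_inv f) := by
    simp [Strict.associator_eqToIso]
  rw [Pseudofunctor.StrongTrans.categoryStruct_comp_naturality_hom]
  exact h

/-- A strict natural isomorphism composed with its inverse is the identity, up to an invertible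
modification whose components are equalities. -/
def toStrongTransIsoId (η : StrictIso F G) :
    η.toStrongTrans ≫ η.symm.toStrongTrans ≅ 𝟙 F.toPseudofunctor :=
  Pseudofunctor.StrongTrans.isoMk (fun a => eqToIso (η.hom_inv a)) fun {a b} f => by
    have h : F.map f ◁ eqToHom (η.hom_inv b) ≫ (ρ_ (F.map f)).hom ≫ (λ_ (F.map f)).inv =
        eqToHom (η.map_comp_hom_inv f) ≫ eqToHom (η.hom_inv a) ▷ F.map f := by
      simp [Strict.leftUnitor_eqToIso, Strict.rightUnitor_eqToIso]
    rw [toStrongTrans_comp_symm_naturality]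
    exact h

/-- The equivalence of pseudofunctors underlying a strict natural isomorphism. -/
def toEquivalence (η : StrictIso F G) : F.toPseudofunctor ≌ G.toPseudofunctor :=
  Bicategory.Equivalence.mkOfAdjointifyCounit η.toStrongTransIsoId.symm η.symm.toStrongTransIsoId

end StrictIso

section Inverse

variable [Strict B] [Strict C]

lemma TwoCell.map_injective (E : StrictPseudofunctor B C) [E.toFunctor.Faithful]
    [∀ a b, (E.mapFunctor a b).Faithful] {a b : B} :
    Function.Injective (TwoCell.map E : TwoCell a b → _) := by
  rintro ⟨f, g, x⟩ ⟨f', g', x'⟩ h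
  obtain rfl : f = f' := E.toFunctor.map_injective (congrArg Arrow.left h)
  obtain rfl : g = g' := E.toFunctor.map_injective (congrArg Arrow.right h)
  obtain rfl : x = x' := (E.mapFunctor a b).map_injective (Arrow.mk_injective _ _ h)
  rfl

variable (E : StrictPseudofunctor B C) [E.toFunctor.IsEquivalence]

/-- The component at `c` of the counit of the equivalence underlying `E`, as a 1-cell. -/
def counit (c : C) : E.obj (E.toFunctor.inv.obj c) ⟶ c := E.toFunctor.asEquivalence.counit.app c

/-- The inverse of the 1-cell `counit E c`. -/
def counitInv (c : C) : c ⟶ E.obj (E.toFunctor.inv.obj c) :=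
  E.toFunctor.asEquivalence.counitInv.app c

lemma counit_comp_counitInv (c : C) : counit E c ≫ counitInv E c = 𝟙 _ :=
  E.toFunctor.asEquivalence.counitIso.hom_inv_id_app c

lemma counitInv_comp_counit (c : C) : counitInv E c ≫ counit E c = 𝟙 _ :=
  E.toFunctor.asEquivalence.counitIso.inv_hom_id_app c

lemma map_inv_map {c d : C} (f : c ⟶ d) :
    E.map (E.toFunctor.inv.map f) = counit E c ≫ f ≫ counitInv E d :=
  E.toFunctor.fun_inv_map _ _ f

variable [∀ a b, (E.mapFunctor a b).Full]

/-- The action on 2-cells of the inverse of a strict 2-functor. -/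
def inverseMap₂ {c d : C} {f g : c ⟶ d} (x : f ⟶ g) :
    E.toFunctor.inv.map f ⟶ E.toFunctor.inv.map g :=
  (E.mapFunctor _ _).preimage
    (eqToHom (map_inv_map E f) ≫ counit E c ◁ x ▷ counitInv E d ≫ eqToHom (map_inv_map E g).symm)

lemma map₂_inverseMap₂ {c d : C} {f g : c ⟶ d} (x : f ⟶ g) :
    E.map₂ (inverseMap₂ E x) = eqToHom (map_inv_map E f) ≫
      counit E c ◁ x ▷ counitInv E d ≫ eqToHom (map_inv_map E g).symm :=
  (E.mapFunctor _ _).map_preimage _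

lemma map_mk_inverseMap₂ {c d : C} {f g : c ⟶ d} (x : f ⟶ g) :
    TwoCell.map E (.mk (inverseMap₂ E x)) =
      ((TwoCell.whiskerRight (.mk x) (counitInv E d)).whiskerLeft (counit E c)) :=
  (TwoCell.mk_eq_iff (map_inv_map E f) (map_inv_map E g) _ _).2 (map₂_inverseMap₂ E x)

variable [∀ a b, (E.mapFunctor a b).Faithful]

/-- The strict 2-functor inverse, up to strict natural isomorphism, to a strict 2-functor that is
an equivalence of underlying categories and fully faithful on 2-cells. -/
def inverse : StrictPseudofunctor C B :=
  StrictPseudofunctor.mk''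
    { obj := E.toFunctor.inv.obj
      map := E.toFunctor.inv.map
      map₂ := inverseMap₂ E
      map₂_id := fun f => (E.mapFunctor _ _).map_injective <| by
        change E.map₂ _ = E.map₂ _
        simp [map₂_inverseMap₂]
      map₂_comp := fun x y => (E.mapFunctor _ _).map_injective <| by
        change E.map₂ _ = E.map₂ _
        simp [map₂_inverseMap₂]
      map_id := E.toFunctor.inv.map_id
      map_comp := E.toFunctor.inv.map_comp
      map₂_whisker_left := fun {c d e} f {g g'} x =>
        (TwoCell.mk_eq_iff (E.toFunctor.inv.map_comp f g) (E.toFunctor.inv.map_comp f g') _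
          (E.toFunctor.inv.map f ◁ inverseMap₂ E x)).1 <| TwoCell.map_injective E <| by
          rw [map_mk_inverseMap₂]
          refine Eq.trans ?_ (TwoCell.map_whiskerLeft E _ (.mk (inverseMap₂ E x))).symm
          rw [map_mk_inverseMap₂, map_inv_map, ← TwoCell.comp_whiskerLeft, Strict.assoc,
            Strict.assoc, counitInv_comp_counit, Strict.comp_id, TwoCell.comp_whiskerLeft]
          exact congrArg (TwoCell.whiskerLeft (counit E c))
            (TwoCell.whisker_assoc f (.mk x) (counitInv E e))
      map₂_whisker_right := fun {c d e} {f f'} x g =>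
        (TwoCell.mk_eq_iff (E.toFunctor.inv.map_comp f g) (E.toFunctor.inv.map_comp f' g) _
          (inverseMap₂ E x ▷ E.toFunctor.inv.map g)).1 <| TwoCell.map_injective E <| by
          rw [map_mk_inverseMap₂]
          refine Eq.trans ?_ (TwoCell.map_whiskerRight E (.mk (inverseMap₂ E x)) _).symm
          rw [map_mk_inverseMap₂, map_inv_map, TwoCell.whisker_assoc, ← TwoCell.whiskerRight_comp,
            ← Strict.assoc, counitInv_comp_counit, Strict.id_comp, TwoCell.whiskerRight_comp]
          rfl }

/-- The strict counit of `inverse`. -/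
def inverseCounit : StrictIso ((inverse E).comp E) (StrictPseudofunctor.id C) where
  hom := counit E
  inv := counitInv E
  hom_inv := counit_comp_counitInv E
  inv_hom := counitInv_comp_counit E
  naturality {c d} x := by
    refine (congrArg (TwoCell.whiskerRight · (counit E d)) (map_mk_inverseMap₂ E x.hom)).trans ?_
    rw [TwoCell.whisker_assoc, ← TwoCell.whiskerRight_comp, counitInv_comp_counit,
      TwoCell.whiskerRight_id]
    rfl

/-- The component at `b` of the inverse of the unit of the equivalence underlying `E`, as a
1-cell. -/
def unitInv (b : B) : (inverse E).obj (E.obj b) ⟶ b := E.toFunctor.asEquivalence.unitInv.app b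

lemma map_unitInv (b : B) : E.map (unitInv E b) = counit E (E.obj b) :=
  E.toFunctor.map_preimage _

/-- The strict unit of `inverse`. -/
def inverseUnit : StrictIso (E.comp (inverse E)) (StrictPseudofunctor.id B) where
  hom := unitInv E
  inv b := E.toFunctor.asEquivalence.unit.app b
  hom_inv b := E.toFunctor.asEquivalence.unitIso.inv_hom_id_app b
  inv_hom b := E.toFunctor.asEquivalence.unitIso.hom_inv_id_app b
  naturality {a b} x := TwoCell.map_injective E <| by
    refine (TwoCell.map_whiskerRight E ((x.map E).map (inverse E)) (unitInv E b)).trans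
      (Eq.trans ?_ (TwoCell.map_whiskerLeft E (unitInv E a) x).symm)
    rw [map_unitInv, map_unitInv]
    exact (inverseCounit E).naturality (x.map E)

theorem isTwoEquivalence_of_isEquivalence (E : StrictPseudofunctor B C) [E.toFunctor.IsEquivalence]
    [∀ a b, (E.mapFunctor a b).Full] [∀ a b, (E.mapFunctor a b).Faithful] :
    IsTwoEquivalence E.toPseudofunctor :=
  ⟨(inverse E).toPseudofunctor, ⟨(inverseCounit E).toEquivalence⟩, ⟨(inverseUnit E).toEquivalence⟩⟩

end Inverse

end Strict

/-! ## The grading group -/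

/-- The group of bidegrees (degree, parity). -/
abbrev Deg := ℤ × ZMod 2

/-- The generator of the degrees. -/
abbrev e₁ : Deg := (1, 0)

/-- The generator of the parities. -/
abbrev e₂ : Deg := (0, 1)

/-- The sign `(-1)^p`. -/
def sgn (p : ZMod 2) : ℤ := (-1) ^ p.val

@[simp] lemma sgn_zero : sgn 0 = 1 := rfl

@[simp] lemma sgn_one : sgn 1 = -1 := rfl

lemma sgn_add (p q : ZMod 2) : sgn (p + q) = sgn p * sgn q := by
  revert p q; decide

lemma sgn_mul_self (p : ZMod 2) : sgn p * sgn p = 1 := by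
  revert p; decide

lemma exists_int_descent {P : ℤ → Type v} (e : ∀ n, P n ≃ P (n + 1)) (x : P 0) :
    ∃ g : ∀ n, P n, g 0 = x ∧ ∀ n, g (n + 1) = e n (g n) := by
  let g₁ : ∀ k : ℕ, P (Int.ofNat k) := fun k =>
    Nat.rec x (fun k (y : P (Int.ofNat k)) => (e (Int.ofNat k) y : P (Int.ofNat k + 1))) k
  let g₂ : ∀ k : ℕ, P (Int.negSucc k) := fun k =>
    Nat.rec ((e (Int.negSucc 0)).symm x) (fun k (y : P (Int.negSucc k)) =>
      (e (Int.negSucc (k + 1))).symm y) k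
  refine ⟨fun n => match n with
    | Int.ofNat k => g₁ k
    | Int.negSucc k => g₂ k, rfl, fun n => ?_⟩
  match n with
  | Int.ofNat k => rfl
  | Int.negSucc 0 => exact ((e (Int.negSucc 0)).apply_symm_apply x).symm
  | Int.negSucc (k + 1) => exact ((e (Int.negSucc (k + 1))).apply_symm_apply (g₂ k)).symm

lemma exists_descent {P : Deg → Type v} (R₁ : ∀ {a b}, b + e₁ = a → (P a ≃ P b))
    (R₂ : ∀ {a b}, a + e₂ = b → P a → P b)
    (h₂₂ : ∀ {a b} (h : a + e₂ = b) (h' : b + e₂ = a) (x : P a), R₂ h' (R₂ h x) = x)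
    (h₁₂ : ∀ {a b a' b'} (h : b + e₁ = a) (h' : b' + e₁ = a') (l : a + e₂ = a')
      (l' : b + e₂ = b') (x : P a), R₁ h' (R₂ l x) = R₂ l' (R₁ h x)) (x : P 0) :
    ∃ f : ∀ a, P a, f 0 = x ∧ (∀ {a b} (h : b + e₁ = a), R₁ h (f a) = f b) ∧
      ∀ {a b} (h : a + e₂ = b), R₂ h (f a) = f b := by
  have hs : ∀ (n : ℤ) (p : ZMod 2), ((n, p) : Deg) + e₁ = (n + 1, p) := fun n p => by simp
  have ht : ∀ n : ℤ, ((n, 0) : Deg) + e₂ = (n, 1) := fun n => by simp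
  obtain ⟨g, hg0, hg⟩ := exists_int_descent (P := fun n => P (n, 0))
    (fun n => (R₁ (hs n 0)).symm) x
  let F : ∀ (n : ℤ) (p : Fin 2), P (n, p) := fun n p => match p with
    | 0 => g n
    | 1 => R₂ (ht n) (g n)
  refine ⟨fun a => F a.1 a.2, hg0, ?_, ?_⟩
  · rintro ⟨m, p⟩ ⟨n, q⟩ h
    obtain ⟨rfl, rfl⟩ : n + 1 = m ∧ q = p := by simpa using h
    have h0 : R₁ (hs n 0) (g (n + 1)) = g n := by rw [hg]; simp
    match q with
    | 0 => exact h0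
    | 1 =>
      change R₁ _ (R₂ _ (g (n + 1))) = R₂ _ (g n)
      rw [h₁₂ (hs n 0) _ _ (ht n), h0]
  · rintro ⟨m, p⟩ ⟨n, q⟩ h
    obtain ⟨rfl, rfl⟩ : m = n ∧ p + 1 = q := by simpa using h
    match p with
    | 0 => rfl
    | 1 => exact h₂₂ (ht m) _ (g m)

lemma deg_induction {P : Deg → Prop} (h0 : P 0) (h1 : ∀ {a b}, b + e₁ = a → (P a ↔ P b))
    (h2 : ∀ {a b}, a + e₂ = b → P a → P b) (a : Deg) : P a := by
  have hs : ∀ n : ℤ, ((n, 0) : Deg) + e₁ = (n + 1, 0) := fun n => by simp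
  have h : ∀ n : ℤ, P (n, 0) := fun n => by
    induction n with
    | zero => exact h0
    | succ n ih => exact (h1 (hs _)).2 ih
    | pred n ih => exact (h1 (by simp)).1 ih
  obtain ⟨n, p⟩ := a
  have hp : p = 0 ∨ p = 1 := by revert p; decide
  obtain rfl | rfl := hp
  · exact h n
  · exact h2 (by simp) (h n)

lemma add_e₁ {a b i : Deg} (h : b + e₁ = a) : b + i + e₁ = a + i := by
  rw [← h]; abel

lemma add_e₂ {a b i : Deg} (h : a + e₂ = b) : a + i + e₂ = b + i := by
  rw [← h]; abel

lemma add_e₂_symm {a b : Deg} (h : a + e₂ = b) : b + e₂ = a := by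
  rw [← h, add_assoc, show e₂ + e₂ = 0 by decide, add_zero]

lemma sgn_smul_eq_iff {M : Type v} [AddCommGroup M] {p : ZMod 2} {x y : M} :
    sgn p • x = y ↔ x = sgn p • y := by
  constructor <;> (rintro rfl; rw [smul_smul, sgn_mul_self, one_smul])

lemma sgn_of_add_e₂ {a b : Deg} (h : a + e₂ = b) : sgn b.2 = - sgn a.2 := by
  rw [← h, Prod.snd_add, sgn_add]; simp

attribute [instance] QPCat.P_additive QPCat.P_linear QPCat.Q_additive QPCat.Q_linear

/-! ## Shift families -/

section ShiftFamily

variable {k : Type w} [CommRing k]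

/-- A family of objects of a `(Q, Π)`-category on which `Q` and `Π` act by shifting the index. -/
structure ShiftFamily (A : QPCat.{w, v, u} k) where
  /-- The members of the family. -/
  obj : Deg → A.carrier
  /-- `Q` lowers the degree by one. -/
  s : ∀ {a b}, b + e₁ = a → (A.Q.functor.obj (obj a) ≅ obj b)
  /-- `Π` changes the parity. -/
  t : ∀ {a b}, a + e₂ = b → (A.P.obj (obj a) ≅ obj b)
  t_t : ∀ {a b} (h : a + e₂ = b) (h' : b + e₂ = a),
    A.P.map (t h).hom ≫ (t h').hom = A.ξ.hom.app (obj a)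
  s_t : ∀ {a b a' b'} (h : b + e₁ = a) (h' : b' + e₁ = a') (l : a + e₂ = a') (l' : b + e₂ = b'),
    A.P.map (s h).hom ≫ (t l').hom =
      A.βQ.hom.app (obj a) ≫ A.Q.functor.map (t l).hom ≫ (s h').hom

namespace ShiftFamily

variable {A : QPCat.{w, v, u} k}

/-- Transport of a component of a morphism of shift families along `Q`. -/
def transportQ (U V : ShiftFamily A) {a b a' b' : Deg} (h : b + e₁ = a) (h' : b' + e₁ = a') :
    (U.obj a ⟶ V.obj a') ≃ₗ[k] (U.obj b ⟶ V.obj b') :=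
  (LinearEquiv.ofBijective (A.Q.functor.mapLinearMap k)
    (A.Q.fullyFaithfulFunctor.map_bijective _ _)).trans (Linear.homCongr k (U.s h) (V.s h'))

lemma transportQ_apply (U V : ShiftFamily A) {a b a' b' : Deg} (h : b + e₁ = a)
    (h' : b' + e₁ = a') (f : U.obj a ⟶ V.obj a') :
    transportQ U V h h' f = (U.s h).inv ≫ A.Q.functor.map f ≫ (V.s h').hom :=
  Category.assoc _ _ _

lemma transportQ_eq_iff {U V : ShiftFamily A} {a b a' b' : Deg} (h : b + e₁ = a)
    (h' : b' + e₁ = a') {f : U.obj a ⟶ V.obj a'} {g : U.obj b ⟶ V.obj b'} :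
    transportQ U V h h' f = g ↔ A.Q.functor.map f ≫ (V.s h').hom = (U.s h).hom ≫ g := by
  rw [transportQ_apply, Iso.inv_comp_eq]

/-- Transport along `Π` of a component of a morphism of shift families of parity `p`. -/
def transportP (U V : ShiftFamily A) (p : ZMod 2) {a b a' b' : Deg} (h : a + e₂ = b)
    (h' : a' + e₂ = b') : (U.obj a ⟶ V.obj a') →ₗ[k] (U.obj b ⟶ V.obj b') :=
  sgn p • (Linear.homCongr k (U.t h) (V.t h')).toLinearMap ∘ₗ A.P.mapLinearMap k

lemma transportP_apply (U V : ShiftFamily A) (p : ZMod 2) {a b a' b' : Deg} (h : a + e₂ = b)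
    (h' : a' + e₂ = b') (f : U.obj a ⟶ V.obj a') :
    transportP U V p h h' f = sgn p • ((U.t h).inv ≫ A.P.map f ≫ (V.t h').hom) := by
  simp [transportP, Linear.homCongr_apply]

lemma transportP_eq_iff {U V : ShiftFamily A} {p : ZMod 2} {a b a' b' : Deg} (h : a + e₂ = b)
    (h' : a' + e₂ = b') {f : U.obj a ⟶ V.obj a'} {g : U.obj b ⟶ V.obj b'} :
    transportP U V p h h' f = g ↔
      A.P.map f ≫ (V.t h').hom = sgn p • ((U.t h).hom ≫ g) := by
  rw [transportP_apply, sgn_smul_eq_iff, Iso.inv_comp_eq, Preadditive.comp_zsmul]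

lemma P_map_t_inv_comp_ξ (U : ShiftFamily A) {a b : Deg} (h : a + e₂ = b) (h' : b + e₂ = a) :
    A.P.map (U.t h).inv ≫ A.ξ.hom.app (U.obj a) = (U.t h').hom := by
  rw [← U.t_t h h', ← Functor.map_comp_assoc]
  simp

lemma transportP_transportP (U V : ShiftFamily A) (p : ZMod 2) {a b a' b' : Deg} (h : a + e₂ = b)
    (h' : a' + e₂ = b') (l : b + e₂ = a) (l' : b' + e₂ = a') (f : U.obj a ⟶ V.obj a') :
    transportP U V p l l' (transportP U V p h h' f) = f := by
  have ξ_natural : A.P.map (A.P.map f) ≫ A.ξ.hom.app (V.obj a') = A.ξ.hom.app (U.obj a) ≫ f :=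
    A.ξ.hom.naturality f
  rw [transportP_eq_iff, transportP_apply]
  simp only [Functor.map_zsmul, Functor.map_comp, Category.assoc, Preadditive.zsmul_comp, t_t,
    ξ_natural, reassoc_of% P_map_t_inv_comp_ξ U h l]

lemma transportP_bijective (U V : ShiftFamily A) (p : ZMod 2) {a b a' b' : Deg} (h : a + e₂ = b)
    (h' : a' + e₂ = b') : Function.Bijective (transportP U V p h h') :=
  Function.bijective_iff_has_inverse.2 ⟨transportP U V p (add_e₂_symm h) (add_e₂_symm h'),
    transportP_transportP U V p h h' _ _, transportP_transportP U V p _ _ h h'⟩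

lemma t_inv_comp_P_map_s_inv (U : ShiftFamily A) {a b a' b' : Deg} (h : b + e₁ = a)
    (h' : b' + e₁ = a') (l : a + e₂ = a') (l' : b + e₂ = b') :
    (U.t l').inv ≫ A.P.map (U.s h).inv ≫ A.βQ.hom.app (U.obj a) =
      (U.s h').inv ≫ A.Q.functor.map (U.t l).inv := by
  rw [Iso.inv_comp_eq, ← Functor.mapIso_inv, Iso.inv_comp_eq, Functor.mapIso_hom,
    reassoc_of% U.s_t h h' l l']
  simp

lemma transportQ_transportP (U V : ShiftFamily A) (p : ZMod 2) {a b a' b' c d c' d' : Deg}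
    (h : b + e₁ = a) (h' : b' + e₁ = a') (l : a + e₂ = a') (l' : b + e₂ = b')
    (m : d + e₁ = c) (m' : d' + e₁ = c') (n : c + e₂ = c') (n' : d + e₂ = d')
    (f : U.obj a ⟶ V.obj c) :
    transportQ U V h' m' (transportP U V p l n f) =
      transportP U V p l' n' (transportQ U V h m f) := by
  have βQ_natural : A.P.map (A.Q.functor.map f) ≫ A.βQ.hom.app (V.obj c) =
      A.βQ.hom.app (U.obj a) ≫ A.Q.functor.map (A.P.map f) := A.βQ.hom.naturality f
  simp only [transportQ_apply, transportP_apply, Functor.map_zsmul, Functor.map_comp,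
    Category.assoc, Preadditive.comp_zsmul, Preadditive.zsmul_comp, V.s_t m m' n n',
    reassoc_of% βQ_natural]
  rw [reassoc_of% t_inv_comp_P_map_s_inv U h h' l l']

/-- The morphisms of bidegree `i` between shift families: families of morphisms raising the index
by `i`, compatible with `Q`, and compatible with `Π` up to the sign given by the parity. The
components are indexed by pairs `(a, b)` with `a + i = b`, so that no component has to be
transported along an equality of indices. -/
def hom (U V : ShiftFamily A) (i : Deg) :
    Submodule k (∀ p : {p : Deg × Deg // p.1 + i = p.2}, U.obj p.1.1 ⟶ V.obj p.1.2) where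
  carrier := {f |
    (∀ {a b a' b'} (h : b + e₁ = a) (h' : b' + e₁ = a') (l : a + i = a') (l' : b + i = b'),
      transportQ U V h h' (f ⟨(a, a'), l⟩) = f ⟨(b, b'), l'⟩) ∧
    ∀ {a b a' b'} (h : a + e₂ = b) (h' : a' + e₂ = b') (l : a + i = a') (l' : b + i = b'),
      transportP U V i.2 h h' (f ⟨(a, a'), l⟩) = f ⟨(b, b'), l'⟩}
  zero_mem' := ⟨fun _ _ _ _ => map_zero _, fun _ _ _ _ => map_zero _⟩
  add_mem' hf hg :=
    ⟨fun h h' l l' => (map_add _ _ _).trans (congrArg₂ _ (hf.1 h h' l l') (hg.1 h h' l l')),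
      fun h h' l l' => (map_add _ _ _).trans (congrArg₂ _ (hf.2 h h' l l') (hg.2 h h' l l'))⟩
  smul_mem' r _ hf :=
    ⟨fun h h' l l' => (map_smul _ _ _).trans (congrArg (r • ·) (hf.1 h h' l l')),
      fun h h' l l' => (map_smul _ _ _).trans (congrArg (r • ·) (hf.2 h h' l l'))⟩

variable {U V W : ShiftFamily A} {i j : Deg}

/-- The component of a morphism of shift families at a pair of indices. -/
def app {a b : Deg} (h : a + i = b) : hom U V i →ₗ[k] (U.obj a ⟶ V.obj b) :=
  LinearMap.proj (⟨(a, b), h⟩ : {p : Deg × Deg // p.1 + i = p.2}) ∘ₗ (hom U V i).subtype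

lemma transportQ_app (f : hom U V i) {a b a' b' : Deg} (h : b + e₁ = a) (h' : b' + e₁ = a')
    (l : a + i = a') (l' : b + i = b') : transportQ U V h h' (app l f) = app l' f :=
  f.2.1 h h' l l'

lemma transportP_app (f : hom U V i) {a b a' b' : Deg} (h : a + e₂ = b) (h' : a' + e₂ = b')
    (l : a + i = a') (l' : b + i = b') : transportP U V i.2 h h' (app l f) = app l' f :=
  f.2.2 h h' l l'

lemma Q_map_app (f : hom U V i) {a b a' b' : Deg} (h : b + e₁ = a) (h' : b' + e₁ = a')
    (l : a + i = a') (l' : b + i = b') :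
    A.Q.functor.map (app l f) ≫ (V.s h').hom = (U.s h).hom ≫ app l' f :=
  (transportQ_eq_iff h h').1 (transportQ_app f h h' l l')

lemma P_map_app (f : hom U V i) {a b a' b' : Deg} (h : a + e₂ = b) (h' : a' + e₂ = b')
    (l : a + i = a') (l' : b + i = b') :
    A.P.map (app l f) ≫ (V.t h').hom = sgn i.2 • ((U.t h).hom ≫ app l' f) :=
  (transportP_eq_iff h h').1 (transportP_app f h h' l l')

/-- Constructor for morphisms of shift families. -/
def homMk (f : ∀ {a b}, a + i = b → (U.obj a ⟶ V.obj b))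
    (hQ : ∀ {a b a' b'} (h : b + e₁ = a) (h' : b' + e₁ = a') (l : a + i = a') (l' : b + i = b'),
      A.Q.functor.map (f l) ≫ (V.s h').hom = (U.s h).hom ≫ f l')
    (hP : ∀ {a b a' b'} (h : a + e₂ = b) (h' : a' + e₂ = b') (l : a + i = a') (l' : b + i = b'),
      A.P.map (f l) ≫ (V.t h').hom = sgn i.2 • ((U.t h).hom ≫ f l')) :
    hom U V i where
  val p := f p.2
  property := ⟨fun h h' l l' => (transportQ_eq_iff h h').2 (hQ h h' l l'),
    fun h h' l l' => (transportP_eq_iff h h').2 (hP h h' l l')⟩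

lemma exists_app_zero_eq (f : U.obj 0 ⟶ V.obj i) : ∃ g : hom U V i, app (zero_add i) g = f := by
  obtain ⟨g, g_zero, hQ, hP⟩ := exists_descent (P := fun a => U.obj a ⟶ V.obj (a + i))
    (fun h => (transportQ U V h (add_e₁ h)).toEquiv)
    (fun h => transportP U V i.2 h (add_e₂ h))
    (fun h h' => transportP_transportP U V i.2 h (add_e₂ h) h' (add_e₂ h'))
    (fun h h' l l' => transportQ_transportP U V i.2 h h' l l' _ _ _ _)
    (f ≫ eqToHom (by rw [zero_add]))
  refine ⟨⟨fun p => g p.1.1 ≫ eqToHom (by rw [p.2]), ?_, ?_⟩, ?_⟩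
  · rintro a b _ _ h h' rfl rfl
    simpa using hQ h
  · rintro a b _ _ h h' rfl rfl
    simpa using hP h
  · simp [app, g_zero]

lemma app_zero_injective : Function.Injective (app (zero_add i) : hom U V i → _) := by
  intro f g hfg
  suffices ∀ {a b} (h : a + i = b), app h f = app h g from
    Subtype.ext (funext fun p => this p.2)
  intro a
  refine deg_induction (P := fun a => ∀ {b} (h : a + i = b), app h f = app h g) ?_ ?_ ?_ a
  · intro b h
    obtain rfl : i = b := by rw [← h, zero_add]
    exact hfg
  · intro a b h
    have transport {a' b'} (l : a + i = a') (l' : b + i = b') (h' : b' + e₁ = a') :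
        app l f = app l g ↔ app l' f = app l' g := by
      rw [← transportQ_app f h h' l l', ← transportQ_app g h h' l l',
        (transportQ U V h h').injective.eq_iff]
    constructor
    · rintro ih _ rfl
      exact (transport rfl rfl (add_e₁ h)).1 (ih rfl)
    · rintro ih _ rfl
      exact (transport rfl rfl (add_e₁ h)).2 (ih rfl)
  · rintro a b h ih _ rfl
    rw [← transportP_app f h (add_e₂ h) rfl rfl, ← transportP_app g h (add_e₂ h) rfl rfl, ih]

lemma app_bijective {a b : Deg} (h : a + i = b) :
    Function.Bijective (app h : hom U V i → (U.obj a ⟶ V.obj b)) := by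
  revert b
  refine deg_induction (P := fun a => ∀ {b} (h : a + i = b),
    Function.Bijective (app h : hom U V i → (U.obj a ⟶ V.obj b))) ?_ ?_ ?_ a
  · rintro b h
    obtain rfl : i = b := by rw [← h, zero_add]
    exact ⟨app_zero_injective, exists_app_zero_eq⟩
  · intro a b h
    have transport {a' b'} (l : a + i = a') (l' : b + i = b') (h' : b' + e₁ = a') :
        (app l' : hom U V i → _) = transportQ U V h h' ∘ app l :=
      funext fun f => (transportQ_app f h h' l l').symm
    constructor
    · rintro ih _ rfl
      rw [transport rfl rfl (add_e₁ h)]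
      exact (transportQ U V h _).bijective.comp (ih rfl)
    · rintro ih _ rfl
      rw [← (transportQ U V h (add_e₁ h)).bijective.of_comp_iff', ← transport rfl rfl (add_e₁ h)]
      exact ih rfl
  · rintro a b h ih _ rfl
    have transport : (app rfl : hom U V i → _) = transportP U V i.2 h (add_e₂ h) ∘ app rfl :=
      funext fun f => (transportP_app f h (add_e₂ h) rfl rfl).symm
    rw [transport]
    exact (transportP_bijective U V i.2 h _).comp (ih rfl)

/-- Evaluation at a pair of indices: any component of a morphism of shift families determines it
and is arbitrary. -/
def appEquiv {a b : Deg} (h : a + i = b) : hom U V i ≃ₗ[k] (U.obj a ⟶ V.obj b) :=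
  LinearEquiv.ofBijective (app h) (app_bijective h)

lemma app_appEquiv_symm {a b : Deg} (h : a + i = b) (f : U.obj a ⟶ V.obj b) :
    app h ((appEquiv h).symm f : hom U V i) = f :=
  (appEquiv h).apply_symm_apply f

lemma hom_ext {f g : hom U V i} {a b : Deg} (h : a + i = b) (hfg : app h f = app h g) : f = g :=
  (app_bijective h).1 hfg

/-- The identity morphism of a shift family. -/
def homId (U : ShiftFamily A) : hom U U 0 :=
  homMk (fun h => eqToHom (by rw [← h, add_zero]))
    (fun {a b a' b'} h h' l l' => by
      obtain rfl : a = a' := by rw [← l, add_zero]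
      obtain rfl : b = b' := by rw [← l', add_zero]
      simp)
    (fun {a b a' b'} h h' l l' => by
      obtain rfl : a = a' := by rw [← l, add_zero]
      obtain rfl : b = b' := by rw [← l', add_zero]
      simp)

lemma app_homId (U : ShiftFamily A) (a : Deg) : app (add_zero a) (homId U) = 𝟙 _ := rfl

/-- Composition of morphisms of shift families. -/
def homComp (f : hom U V i) (g : hom V W j) : hom U W (i + j) :=
  homMk (fun {a _} h => app (i := i) rfl f ≫ app ((add_assoc a i j).trans h) g)
    (fun h h' l l' => by
      rw [Functor.map_comp, Category.assoc, Q_map_app g (add_e₁ h) h',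
        reassoc_of% Q_map_app f h (add_e₁ h)])
    (fun h h' l l' => by
      rw [Functor.map_comp, Category.assoc, P_map_app g (add_e₂ h) h', Preadditive.comp_zsmul,
        reassoc_of% P_map_app f h (add_e₂ h), Preadditive.zsmul_comp, smul_smul, Category.assoc,
        Prod.snd_add, sgn_add, mul_comm])

lemma app_homComp (f : hom U V i) (g : hom V W j) {a b c : Deg} (h : a + i = b) (h' : b + j = c)
    (l : a + (i + j) = c) : app l (homComp f g) = app h f ≫ app h' g := by
  subst h
  rfl

/-- Composition of morphisms of shift families, as a bilinear map. -/
def homCompₗ (U V W : ShiftFamily A) (i j : Deg) :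
    hom U V i →ₗ[k] hom V W j →ₗ[k] hom U W (i + j) :=
  LinearMap.mk₂ k homComp
    (fun _ _ _ => Subtype.ext (funext fun _ => Preadditive.add_comp _ _ _ _ _ _))
    (fun _ _ _ => Subtype.ext (funext fun _ => Linear.smul_comp _ _ _ _ _ _))
    (fun _ _ _ => Subtype.ext (funext fun _ => Preadditive.comp_add _ _ _ _ _ _))
    (fun _ _ _ => Subtype.ext (funext fun _ => Linear.comp_smul _ _ _ _ _ _))

end ShiftFamily

end ShiftFamily

section Family

variable {k : Type w} [CommRing k]

namespace QPCat

variable (A : QPCat.{w, v, u} k)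

/-- The objects `Q⁻ⁿ X`. -/
def shiftZ (X : A.carrier) : ℤ → A.carrier
  | Int.ofNat n => A.Q.inverse.obj^[n] X
  | Int.negSucc n => A.Q.functor.obj^[n + 1] X

/-- The isomorphisms `Q Q⁻ⁿ⁻¹ X ≅ Q⁻ⁿ X`. -/
def shiftZIso (X : A.carrier) : ∀ n : ℤ,
    A.Q.functor.obj (A.shiftZ X (n + 1)) ≅ A.shiftZ X n
  | Int.ofNat n => A.Q.functor.mapIso (eqToIso (Function.iterate_succ_apply' _ _ _)) ≪≫
      A.Q.counitIso.app (A.shiftZ X n)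
  | Int.negSucc 0 => Iso.refl (A.Q.functor.obj X)
  | Int.negSucc (_ + 1) => eqToIso (Function.iterate_succ_apply' _ _ _).symm

/-- The object `X` or `Π X`, depending on the parity. -/
def shiftP (X : A.carrier) : Fin 2 → A.carrier
  | 0 => X
  | 1 => A.P.obj X

/-- The isomorphisms `Π Π^p X ≅ Π^{p+1} X`. -/
def shiftPIso (X : A.carrier) : ∀ p : Fin 2, A.P.obj (A.shiftP X p) ≅ A.shiftP X (p + 1)
  | 0 => Iso.refl (A.P.obj X)
  | 1 => A.ξ.app X

/-- The isomorphisms `Q Π^p X ≅ Π^p Y` induced by an isomorphism `Q X ≅ Y`. -/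
def shiftSIso {X Y : A.carrier} (e : A.Q.functor.obj X ≅ Y) :
    ∀ p : Fin 2, A.Q.functor.obj (A.shiftP X p) ≅ A.shiftP Y p
  | 0 => e
  | 1 => (A.βQ.app X).symm ≪≫ A.P.mapIso e

lemma shiftPIso_comp (X : A.carrier) : ∀ p : Fin 2, ∀ h : A.shiftP X (p + 1 + 1) = A.shiftP X p,
    A.P.map (A.shiftPIso X p).hom ≫ (A.shiftPIso X (p + 1)).hom ≫ eqToHom h =
      A.ξ.hom.app (A.shiftP X p)
  | 0, h => by
    change A.P.map (𝟙 _) ≫ A.ξ.hom.app X ≫ 𝟙 _ = A.ξ.hom.app X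
    simp
  | 1, h => by
    change A.P.map (A.ξ.hom.app X) ≫ 𝟙 _ ≫ 𝟙 _ = A.ξ.hom.app (A.P.obj X)
    simp [A.ξ_comm]

lemma shiftPIso_shiftSIso {X Y : A.carrier} (e : A.Q.functor.obj X ≅ Y) : ∀ p : Fin 2,
    A.P.map (A.shiftSIso e p).hom ≫ (A.shiftPIso Y p).hom =
      A.βQ.hom.app (A.shiftP X p) ≫ A.Q.functor.map (A.shiftPIso X p).hom ≫
        (A.shiftSIso e (p + 1)).hom
  | 0 => by
    change A.P.map e.hom ≫ 𝟙 _ = A.βQ.hom.app X ≫ A.Q.functor.map (𝟙 _) ≫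
      A.βQ.inv.app X ≫ A.P.map e.hom
    simp
  | 1 => by
    change A.P.map (A.βQ.inv.app X ≫ A.P.map e.hom) ≫ A.ξ.hom.app Y =
      A.βQ.hom.app (A.P.obj X) ≫ A.Q.functor.map (A.ξ.hom.app X) ≫ e.hom
    have ξ_natural : A.P.map (A.P.map e.hom) ≫ A.ξ.hom.app Y = A.ξ.hom.app _ ≫ e.hom :=
      A.ξ.hom.naturality e.hom
    have βQ_ξ := A.βQ_ξ X
    rw [Functor.map_comp, Category.assoc, ξ_natural, ← cancel_epi (A.P.map (A.βQ.hom.app X)),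
      ← Functor.map_comp_assoc]
    simp [← reassoc_of% βQ_ξ, ← Functor.map_comp_assoc]

/-- The shift family of an object `X`, with `Π^p Q⁻ⁿ X` at the index `(n, p)`. -/
def family (X : A.carrier) : ShiftFamily A where
  obj a := A.shiftP (A.shiftZ X a.1) a.2
  s {a b} h := A.shiftSIso (A.Q.functor.mapIso (eqToIso (by rw [← h]; simp)) ≪≫
      A.shiftZIso X b.1) a.2 ≪≫ eqToIso (by rw [← h]; simp)
  t {a b} h := A.shiftPIso (A.shiftZ X a.1) a.2 ≪≫ eqToIso (by
    rw [← h]; exact congrArg (A.shiftP · _) (congrArg (A.shiftZ X) (add_zero a.1).symm))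
  t_t {a b} h h' := by
    obtain ⟨m, p⟩ := a
    obtain rfl : (m, p + 1) = b := by rw [← h]; simp
    rw [Iso.trans_hom, Iso.trans_hom, eqToIso_refl, Iso.refl_hom, Category.comp_id]
    exact A.shiftPIso_comp (A.shiftZ X m) p (congrArg (A.shiftP _) (congrArg Prod.snd h'))
  s_t {a b a' b'} h h' l l' := by
    obtain ⟨n, p⟩ := b
    obtain rfl : (n + 1, p) = a := by rw [← h]; simp
    obtain rfl : (n, p + 1) = b' := by rw [← l']; simp
    obtain rfl : (n + 1, p + 1) = a' := by rw [← l]; simp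
    simp only [eqToIso_refl, Iso.trans_hom, Functor.mapIso_refl, Iso.refl_trans, Iso.refl_hom,
      Category.comp_id]
    exact A.shiftPIso_shiftSIso (A.shiftZIso X n) p

end QPCat

end Family

/-! ## The graded supercategory of a `(Q, Π)`-category -/

lemma isInternal_range_lof {R : Type w} [Semiring R] {ι : Type u₁} [DecidableEq ι]
    (M : ι → Type v₁) [∀ i, AddCommMonoid (M i)] [∀ i, Module R (M i)] :
    DirectSum.IsInternal fun i => LinearMap.range (DirectSum.lof R ι M i) := by
  let e : (DirectSum ι M) ≃ₗ[R] DirectSum ι fun i => LinearMap.range (DirectSum.lof R ι M i) :=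
    DFinsupp.mapRange.linearEquiv fun i =>
      LinearEquiv.ofInjective (DirectSum.lof R ι M i) (DirectSum.of_injective i)
  have h : DirectSum.coeLinearMap (fun i => LinearMap.range (DirectSum.lof R ι M i)) ∘ₗ
      e.toLinearMap = LinearMap.id := by
    ext i x
    have e_lof : e (DirectSum.lof R ι M i x) =
        DirectSum.lof R ι _ i ⟨DirectSum.lof R ι M i x, x, rfl⟩ :=
      DFinsupp.mapRange_single (hf := fun _ => map_zero _)
    simp only [LinearMap.comp_apply, LinearEquiv.coe_coe, e_lof, LinearMap.id_apply]
    rw [DirectSum.coeLinearMap_lof]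
  exact (Function.Bijective.of_comp_iff _ e.bijective).1
    (show Function.Bijective (DirectSum.coeLinearMap _ ∘ₗ e.toLinearMap) from
      h ▸ Function.bijective_id)

section Super

variable {k : Type w} [CommRing k]

/-- The objects of the graded supercategory associated with a `(Q, Π)`-category. -/
structure Super (A : QPCat.{w, v, u} k) : Type u where
  /-- An object of a `(Q, Π)`-category, viewed in the associated graded supercategory. -/
  of ::
  /-- The corresponding object of the `(Q, Π)`-category. -/
  as : A.carrier

namespace Super

open ShiftFamily

variable {A : QPCat.{w, v, u} k} {X Y Z W : Super A} {i j : Deg}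

/-- The homogeneous morphisms of a given bidegree. -/
abbrev Homog (X Y : Super A) (i : Deg) : Type v := hom (A.family X.as) (A.family Y.as) i

/-- The morphisms, as sums of homogeneous ones. -/
abbrev Hom (X Y : Super A) : Type v := DirectSum Deg (Homog X Y)

/-- The inclusion of the homogeneous morphisms. -/
abbrev incl (X Y : Super A) (i : Deg) : Homog X Y i →ₗ[k] Hom X Y :=
  DirectSum.lof k Deg (Homog X Y) i

lemma incl_congr {f : Homog X Y i} {g : Homog X Y j} {a b : Deg} (h : a + i = b) (h' : a + j = b)
    (hfg : app h f = app h' g) : incl X Y i f = incl X Y j g := by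
  obtain rfl : i = j := add_left_cancel (h.trans h'.symm)
  rw [hom_ext h hfg]

/-- Composition of morphisms, as a bilinear map. -/
def compₗ (X Y Z : Super A) : Hom X Y →ₗ[k] Hom Y Z →ₗ[k] Hom X Z :=
  DirectSum.toModule k Deg _ fun i => LinearMap.flip <| DirectSum.toModule k Deg _ fun j =>
    LinearMap.flip <| (homCompₗ _ _ _ i j).compr₂ (incl X Z (i + j))

lemma compₗ_incl (f : Homog X Y i) (g : Homog Y Z j) :
    compₗ X Y Z (incl X Y i f) (incl Y Z j g) = incl X Z (i + j) (homComp f g) := by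
  simp [compₗ, homCompₗ, incl]

lemma compₗ_id_left (f : Hom X Y) : compₗ X X Y (incl X X 0 (homId _)) f = f := by
  induction f using DirectSum.induction_on with
  | zero => exact map_zero _
  | of i f =>
    refine (compₗ_incl _ f).trans (incl_congr (by rw [zero_add, zero_add]) (zero_add i) ?_)
    rw [app_homComp _ _ (add_zero 0) (zero_add i), app_homId, Category.id_comp]
  | add f g hf hg => rw [map_add, hf, hg]

lemma compₗ_id_right (f : Hom X Y) : compₗ X Y Y f (incl Y Y 0 (homId _)) = f := by
  induction f using DirectSum.induction_on with
  | zero => exact LinearMap.map_zero₂ _ _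
  | of i f =>
    refine (compₗ_incl f _).trans (incl_congr (by rw [add_zero, zero_add]) (zero_add i) ?_)
    rw [app_homComp _ _ (zero_add i) (add_zero i), app_homId, Category.comp_id]
  | add f g hf hg => rw [LinearMap.map_add₂, hf, hg]

lemma compₗ_assoc (f : Hom X Y) (g : Hom Y Z) (h : Hom Z W) :
    compₗ X Z W (compₗ X Y Z f g) h = compₗ X Y W f (compₗ Y Z W g h) := by
  induction f using DirectSum.induction_on with
  | zero => simp only [map_zero, LinearMap.zero_apply]
  | add f f' hf hf' => simp only [map_add, LinearMap.add_apply, hf, hf']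
  | of i f =>
  induction g using DirectSum.induction_on with
  | zero => simp only [map_zero, LinearMap.zero_apply]
  | add g g' hg hg' => simp only [map_add, LinearMap.add_apply, hg, hg']
  | of j g =>
  induction h using DirectSum.induction_on with
  | zero => simp only [map_zero]
  | add h h' hh hh' => simp only [map_add, hh, hh']
  | of l h =>
    change compₗ X Z W (compₗ X Y Z (incl _ _ i f) (incl _ _ j g)) (incl _ _ l h) =
      compₗ X Y W (incl _ _ i f) (compₗ Y Z W (incl _ _ j g) (incl _ _ l h))
    simp only [compₗ_incl]
    refine incl_congr (zero_add _) (by rw [zero_add, add_assoc]) ?_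
    rw [app_homComp _ _ (zero_add (i + j)) rfl, app_homComp _ _ (zero_add i) rfl,
      app_homComp _ _ (zero_add i) (add_assoc i j l).symm, app_homComp _ _ rfl rfl, Category.assoc]

instance : Category.{v} (Super A) where
  Hom := Hom
  id X := incl X X 0 (homId _)
  comp {X Y Z} f g := compₗ X Y Z f g
  id_comp := compₗ_id_left
  comp_id := compₗ_id_right
  assoc := compₗ_assoc

instance : Preadditive (Super A) where
  homGroup X Y := inferInstanceAs (AddCommGroup (Hom X Y))
  add_comp X Y Z f f' g := LinearMap.map_add₂ (compₗ X Y Z) f f' g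
  comp_add X Y Z f g g' := LinearMap.map_add (compₗ X Y Z f) g g'

instance : Linear k (Super A) where
  homModule X Y := inferInstanceAs (Module k (Hom X Y))
  smul_comp X Y Z r f g := LinearMap.map_smul₂ (compₗ X Y Z) r f g
  comp_smul X Y Z f r g := LinearMap.map_smul (compₗ X Y Z f) r g

/-- A morphism of the shift families of two objects, viewed as a homogeneous morphism between the
objects. -/
def ofHomog : Homog X Y i →ₗ[k] (X ⟶ Y) := incl X Y i

lemma ofHomog_comp (f : Homog X Y i) (g : Homog Y Z j) :
    ofHomog f ≫ ofHomog g = ofHomog (homComp f g) :=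
  compₗ_incl f g

lemma ofHomog_homId (X : Super A) : ofHomog (homId _) = 𝟙 X := rfl

instance : GradedSupercategory k (Super A) where
  homog X Y i := LinearMap.range (ofHomog : Homog X Y i →ₗ[k] (X ⟶ Y))
  isInternal X Y := isInternal_range_lof (Homog X Y)
  id_mem X := ⟨_, ofHomog_homId X⟩
  comp_mem := by
    rintro X Y Z i j _ _ ⟨f, rfl⟩ ⟨g, rfl⟩
    exact ⟨_, (ofHomog_comp f g).symm⟩

lemma ofHomog_mem (f : Homog X Y i) : ofHomog f ∈ homog k X Y i := ⟨f, rfl⟩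

lemma ofHomog_congr {f : Homog X Y i} {g : Homog X Y j} {a b : Deg} (h : a + i = b)
    (h' : a + j = b) (hfg : app h f = app h' g) : ofHomog f = ofHomog g :=
  incl_congr h h' hfg

lemma ofHomog_injective : Function.Injective (ofHomog : Homog X Y i → (X ⟶ Y)) :=
  DirectSum.of_injective (β := Homog X Y) i

end Super

end Super

/-! ## Functors defined on homogeneous morphisms -/

section Homogeneous

variable {k : Type w} [CommRing k] {C : Type u₁} [Category.{v₁} C] [Preadditive C] [Linear k C]
  [GradedSupercategory k C]

/-- The decomposition of morphisms into homogeneous components. -/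
def homogEquiv (X Y : C) : (DirectSum Deg fun i => homog k X Y i) ≃ₗ[k] (X ⟶ Y) :=
  LinearEquiv.ofBijective (DirectSum.coeLinearMap (homog k X Y))
    (GradedSupercategory.isInternal (k := k) X Y)

lemma homogEquiv_lof {X Y : C} {i : Deg} (f : homog k X Y i) :
    homogEquiv X Y (DirectSum.lof k Deg (fun i => homog k X Y i) i f) = f.1 :=
  DirectSum.coeLinearMap_lof _ _ _

/-- The linear map on all morphisms with given restrictions to the homogeneous ones. -/
def homogLift {X Y : C} {M : Type v₂} [AddCommMonoid M] [Module k M]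
    (m : ∀ i, homog k X Y i →ₗ[k] M) : (X ⟶ Y) →ₗ[k] M :=
  DirectSum.toModule k Deg M m ∘ₗ (homogEquiv X Y).symm.toLinearMap

lemma homogLift_apply {X Y : C} {M : Type v₂} [AddCommMonoid M] [Module k M]
    (m : ∀ i, homog k X Y i →ₗ[k] M) {i : Deg} {f : X ⟶ Y} (hf : f ∈ homog k X Y i) :
    homogLift m f = m i ⟨f, hf⟩ := by
  have h : (homogEquiv X Y).symm f =
      DirectSum.lof k Deg (fun i => homog k X Y i) i ⟨f, hf⟩ := by
    rw [LinearEquiv.symm_apply_eq, homogEquiv_lof]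
  simp [homogLift, h]

variable {D : Type u₂} [Category.{v₂} D] [Preadditive D] [Linear k D]

/-- The functor with a given action on homogeneous morphisms. -/
def functorOfHomog (obj : C → D) (m : ∀ X Y i, homog k X Y i →ₗ[k] (obj X ⟶ obj Y))
    (hid : ∀ X, m X X 0 ⟨𝟙 X, GradedSupercategory.id_mem X⟩ = 𝟙 _)
    (hcomp : ∀ {X Y Z i j} (f : X ⟶ Y) (hf : f ∈ homog k X Y i) (g : Y ⟶ Z)
      (hg : g ∈ homog k Y Z j),
      m X Z (i + j) ⟨f ≫ g, GradedSupercategory.comp_mem hf hg⟩ =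
        m X Y i ⟨f, hf⟩ ≫ m Y Z j ⟨g, hg⟩) : C ⥤ D where
  obj := obj
  map {X Y} := homogLift (m X Y)
  map_id X := by rw [homogLift_apply _ (GradedSupercategory.id_mem X), hid]
  map_comp {X Y Z} f g := by
    refine hom_induction (k := k) (P := fun f => homogLift (m X Z) (f ≫ g) =
      homogLift (m X Y) f ≫ homogLift (m Y Z) g) (by simp) (fun f f' hf hf' => ?_)
      (fun i f hf => ?_) f
    · simp only [Preadditive.add_comp, map_add, hf, hf']
    refine hom_induction (k := k) (P := fun g => homogLift (m X Z) (f ≫ g) =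
      homogLift (m X Y) f ≫ homogLift (m Y Z) g) (by simp) (fun g g' hg hg' => ?_)
      (fun j g hg => ?_) g
    · simp only [Preadditive.comp_add, map_add, hg, hg']
    rw [homogLift_apply _ hf, homogLift_apply _ hg,
      homogLift_apply _ (GradedSupercategory.comp_mem hf hg), hcomp]

section

variable {obj : C → D} {m : ∀ X Y i, homog k X Y i →ₗ[k] (obj X ⟶ obj Y)} {hid hcomp}

lemma functorOfHomog_map {X Y : C} {i : Deg} {f : X ⟶ Y} (hf : f ∈ homog k X Y i) :
    (functorOfHomog obj m hid hcomp).map f = m X Y i ⟨f, hf⟩ :=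
  homogLift_apply (m X Y) hf

lemma isGradedSuperfunctor_functorOfHomog [GradedSupercategory k D]
    (hm : ∀ X Y i f, m X Y i f ∈ homog k (obj X) (obj Y) i) :
    IsGradedSuperfunctor k (functorOfHomog obj m hid hcomp) where
  additive := ⟨(homogLift (m _ _)).map_add _ _⟩
  linear := ⟨fun f r => (homogLift (m _ _)).map_smul r f⟩
  map_mem hf := by rw [functorOfHomog_map hf]; exact hm _ _ _ _

end

lemma neg_one_pow_val_mul_add (q p p' : ZMod 2) : (-1 : ℤ) ^ (q.val * (p + p').val) =
    (-1) ^ (q.val * p.val) * (-1) ^ (q.val * p'.val) := by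
  revert q p p'; decide

/-- The superfunctor with given values on objects that makes given homogeneous isomorphisms into
a supernatural transformation to the identity. -/
def conjFunctor {obj : C → C} (z : ∀ X, obj X ≅ X) (q : ZMod 2) : C ⥤ C :=
  functorOfHomog obj
    (fun X Y i => ((-1 : ℤ) ^ (q.val * i.2.val)) • ((Linear.leftComp k _ (z X).hom) ∘ₗ
      (Linear.rightComp k _ (z Y).inv) ∘ₗ (homog k X Y i).subtype))
    (fun X => by simp)
    (fun {X Y Z i j} f hf g hg => by
      simp [neg_one_pow_val_mul_add, smul_smul, mul_comm])

variable (k) in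
lemma conjFunctor_map {obj : C → C} (z : ∀ X, obj X ≅ X) (q : ZMod 2) {X Y : C} {i : Deg}
    {f : X ⟶ Y} (hf : f ∈ homog k X Y i) : (conjFunctor (k := k) z q).map f =
      (((-1 : ℤ) ^ (q.val * i.2.val)) • ((z X).hom ≫ f ≫ (z Y).inv) : obj X ⟶ obj Y) :=
  functorOfHomog_map hf

variable {obj : C → C} {z : ∀ X, obj X ≅ X} {n : ℤ} {q : ZMod 2}
  (hz : ∀ X, (z X).hom ∈ homog k (obj X) X (n, q))

include hz

lemma isGradedSuperfunctor_conjFunctor : IsGradedSuperfunctor k (conjFunctor (k := k) z q) :=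
  isGradedSuperfunctor_functorOfHomog fun X Y i f => by
    have h := GradedSupercategory.comp_mem (hz X)
      (GradedSupercategory.comp_mem f.2 (inv_mem (z Y) (hz Y)))
    rw [add_neg_cancel_comm_assoc] at h
    exact zsmul_mem h _

lemma isSupernatural_conjFunctor :
    IsSupernatural k (conjFunctor (k := k) z q) (𝟭 C) n q fun X => (z X).hom where
  mem := hz
  comm {X Y m p f} hf := by
    have conj_comp : ((z X).hom ≫ f ≫ (z Y).inv) ≫ (z Y).hom = (z X).hom ≫ f := by simp
    rw [conjFunctor_map k z q hf]
    exact (Preadditive.zsmul_comp _ _ _).trans (congrArg (_ • ·) conj_comp)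

end Homogeneous

/-! ## The graded `(Q, Π)`-supercategory of a `(Q, Π)`-category -/

namespace Super

open ShiftFamily

variable {k : Type w} [CommRing k] {A : QPCat.{w, v, u} k} {X Y Z : Super A} {i : Deg}

lemma ofHomog_comp_eq {Y' : Super A} {i' j j' : Deg} {f : Homog X Y i} {g : Homog Y Z j}
    {f' : Homog X Y' i'} {g' : Homog Y' Z j'} {a b b' c : Deg} (h : a + i = b) (h' : b + j = c)
    (l : a + i' = b') (l' : b' + j' = c) (hfg : app h f ≫ app h' g = app l f' ≫ app l' g') :
    ofHomog f ≫ ofHomog g = ofHomog f' ≫ ofHomog g' := by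
  rw [ofHomog_comp, ofHomog_comp]
  refine ofHomog_congr (a := a) (b := c) (by rw [← h', ← h, add_assoc])
    (by rw [← l', ← l, add_assoc]) ?_
  rw [app_homComp f g h h', app_homComp f' g' l l', hfg]

lemma ofHomog_comp_eq_ofHomog {j l : Deg} {f : Homog X Y i} {g : Homog Y Z j} {e : Homog X Z l}
    {a b c : Deg} (h : a + i = b) (h' : b + j = c) (m : a + l = c)
    (hfg : app h f ≫ app h' g = app m e) : ofHomog f ≫ ofHomog g = ofHomog e := by
  rw [ofHomog_comp]
  refine ofHomog_congr (a := a) (b := c) (by rw [← h', ← h, add_assoc]) m ?_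
  rw [app_homComp f g h h', hfg]

/-- The homogeneous isomorphism with a given component of index `0`. -/
def isoOf (e : (A.family X.as).obj 0 ≅ (A.family Y.as).obj i) : X ≅ Y where
  hom := ofHomog ((appEquiv (zero_add i)).symm e.hom)
  inv := ofHomog ((appEquiv (add_neg_cancel i)).symm e.inv)
  hom_inv_id := by
    rw [← ofHomog_homId X]
    refine ofHomog_comp_eq_ofHomog (zero_add i) (add_neg_cancel i) (add_zero 0) ?_
    rw [app_appEquiv_symm, app_appEquiv_symm, app_homId, Iso.hom_inv_id]
  inv_hom_id := by
    rw [← ofHomog_homId Y]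
    refine ofHomog_comp_eq_ofHomog (add_neg_cancel i) (zero_add i) (add_zero i) ?_
    rw [app_appEquiv_symm, app_appEquiv_symm, app_homId, Iso.inv_hom_id]

/-- The morphism of shift families underlying the isomorphism `Π X ≅ X`. -/
def zetaHomog (X : Super A) : Homog (of (A.P.obj X.as)) X e₂ :=
  (appEquiv (zero_add e₂)).symm ((A.family X.as).t (zero_add e₂)).hom

lemma app_zetaHomog (X : Super A) :
    app (zero_add e₂) (zetaHomog X) = ((A.family X.as).t (zero_add e₂)).hom :=
  app_appEquiv_symm _ _

/-- The morphism of shift families underlying the isomorphism `Q X ≅ X`. -/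
def sigmaHomog (X : Super A) : Homog (of (A.Q.functor.obj X.as)) X (-e₁) :=
  (appEquiv (zero_add (-e₁))).symm ((A.family X.as).s (neg_add_cancel e₁)).hom

lemma app_sigmaHomog (X : Super A) :
    app (zero_add (-e₁)) (sigmaHomog X) = ((A.family X.as).s (neg_add_cancel e₁)).hom :=
  app_appEquiv_symm _ _

variable (A)

/-- The isomorphism `Π X ≅ X` of odd parity. -/
def zeta (X : Super A) : of (A.P.obj X.as) ≅ X :=
  isoOf (i := e₂) ((A.family X.as).t (zero_add e₂))

/-- The isomorphism `Q X ≅ X` of degree `-1`. -/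
def sigma (X : Super A) : of (A.Q.functor.obj X.as) ≅ X :=
  isoOf (i := -e₁) ((A.family X.as).s (neg_add_cancel e₁))

/-- The isomorphism `Q⁻¹ X ≅ X` of degree `1`. -/
def sigma' (X : Super A) : of (A.Q.inverse.obj X.as) ≅ X :=
  isoOf (i := e₁) (Iso.refl (A.Q.inverse.obj X.as))

end Super

/-- The graded `(Q, Π)`-supercategory associated with a `(Q, Π)`-category. -/
abbrev D {k : Type w} [CommRing k] (A : QPCat.{w, v, u} k) : QPSupercat.{w, v, u} k where
  carrier := Super A
  P := conjFunctor (k := k) (Super.zeta A) 1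
  Q := conjFunctor (k := k) (Super.sigma A) 0
  Qinv := conjFunctor (k := k) (Super.sigma' A) 0
  ζ := Super.zeta A
  σ := Super.sigma A
  σ' := Super.sigma' A
  hP := isGradedSuperfunctor_conjFunctor (n := 0) fun _ => Super.ofHomog_mem _
  hQ := isGradedSuperfunctor_conjFunctor (n := -1) fun _ => Super.ofHomog_mem _
  hQinv := isGradedSuperfunctor_conjFunctor (n := 1) fun _ => Super.ofHomog_mem _
  hζ := isSupernatural_conjFunctor fun _ => Super.ofHomog_mem _
  hσ := isSupernatural_conjFunctor fun _ => Super.ofHomog_mem _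
  hσ' := isSupernatural_conjFunctor fun _ => Super.ofHomog_mem _

/-! ## A `(Q, Π)`-category is isomorphic to the underlying category of its graded supercategory -/

section Comparison

variable {k : Type w} [CommRing k]

lemma xiIso_hom (A : QPSupercat.{w, v, u} k) (X : A.carrier) :
    (xiIso A X).hom = -((A.ζ (A.P.obj X)).hom ≫ (A.ζ X).hom) := by
  simp [xiIso, P_map_ζ]

lemma betaIso_Q_comp (A : QPSupercat.{w, v, u} k) (X : A.carrier) :
    (betaIso A.Q X).hom ≫ (A.σ (A.P.obj X)).hom ≫ (A.ζ X).hom =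
      (A.ζ (A.Q.obj X)).hom ≫ (A.σ X).hom := by
  rw [betaIso_hom A.hQ, Category.assoc, map_σ_assoc, Iso.inv_hom_id, Category.comp_id]

/-- The component of index `0` of the shift family of an object. -/
def QPCat.familyZero (A : QPCat.{w, v, u} k) (X : A.carrier) : (A.family X).obj 0 ≅ X :=
  Iso.refl X

namespace Super

open ShiftFamily

variable {A : QPCat.{w, v, u} k} {X Y Z : A.carrier}

/-- The morphism of shift families given by a morphism of the `(Q, Π)`-category. -/
def evHomog : (X ⟶ Y) ≃ₗ[k] Homog (of X) (of Y) 0 :=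
  (Linear.homCongr k (A.familyZero X) (A.familyZero Y)).symm.trans (appEquiv (zero_add 0)).symm

lemma app_evHomog (f : X ⟶ Y) : app (zero_add 0) (evHomog f) = f :=
  (app_appEquiv_symm _ _).trans ((Category.id_comp _).trans (Category.comp_id f))

/-- The even morphism of degree zero given by a morphism of the `(Q, Π)`-category. -/
def ev : (X ⟶ Y) →ₗ[k] (of X ⟶ of Y) := ofHomog ∘ₗ evHomog.toLinearMap

lemma ev_mem (f : X ⟶ Y) : ev f ∈ homog k (of X) (of Y) 0 := ofHomog_mem (evHomog f)

lemma ev_injective : Function.Injective (ev : (X ⟶ Y) →ₗ[k] (of X ⟶ of Y)) :=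
  ofHomog_injective.comp evHomog.injective

lemma exists_ev_eq {f : of X ⟶ of Y} (hf : f ∈ homog k (of X) (of Y) 0) : ∃ g, ev g = f := by
  obtain ⟨g, rfl⟩ := hf
  exact ⟨evHomog.symm g, congrArg ofHomog (evHomog.apply_symm_apply g)⟩

lemma ev_id (X : A.carrier) : ev (𝟙 X) = 𝟙 (of X) :=
  ofHomog_congr (zero_add 0) (add_zero 0) (app_evHomog (𝟙 X))

lemma ev_comp (f : X ⟶ Y) (g : Y ⟶ Z) : ev (f ≫ g) = ev f ≫ ev g := by
  refine (ofHomog_comp_eq_ofHomog (f := evHomog f) (g := evHomog g) (e := evHomog (f ≫ g))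
    (zero_add 0) (zero_add 0) (zero_add 0) ?_).symm
  rw [app_evHomog, app_evHomog, app_evHomog]
  rfl

lemma ev_zeta (f : X ⟶ Y) :
    ev (A.P.map f) ≫ (zeta A (of Y)).hom = (zeta A (of X)).hom ≫ ev f := by
  refine ofHomog_comp_eq (f := evHomog (A.P.map f)) (g := zetaHomog (of Y)) (f' := zetaHomog (of X))
    (g' := evHomog f) (zero_add 0) (zero_add e₂) (zero_add e₂) (add_zero e₂) ?_
  have h := P_map_app (evHomog f) (zero_add e₂) (zero_add e₂) (zero_add 0) (add_zero e₂)
  rw [app_evHomog, Prod.snd_zero, sgn_zero, one_smul] at h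
  rw [app_evHomog, app_zetaHomog, app_zetaHomog]
  exact h

lemma ev_sigma (f : X ⟶ Y) :
    ev (A.Q.functor.map f) ≫ (sigma A (of Y)).hom = (sigma A (of X)).hom ≫ ev f := by
  refine ofHomog_comp_eq (f := evHomog (A.Q.functor.map f)) (g := sigmaHomog (of Y))
    (f' := sigmaHomog (of X)) (g' := evHomog f) (zero_add 0) (zero_add (-e₁)) (zero_add (-e₁))
    (add_zero (-e₁)) ?_
  have h := Q_map_app (evHomog f) (neg_add_cancel e₁) (neg_add_cancel e₁) (zero_add 0)
    (add_zero (-e₁))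
  rw [app_evHomog] at h
  rw [app_evHomog, app_sigmaHomog, app_sigmaHomog]
  exact h

lemma zeta_zeta (X : A.carrier) :
    (zeta A (of (A.P.obj X))).hom ≫ (zeta A (of X)).hom = -ev (A.ξ.hom.app X) := by
  rw [← map_neg]
  have e₂_add_e₂ : e₂ + e₂ = 0 := by decide
  refine ofHomog_comp_eq_ofHomog (f := zetaHomog (of (A.P.obj X))) (g := zetaHomog (of X))
    (e := evHomog (-A.ξ.hom.app X)) (zero_add e₂) e₂_add_e₂ (zero_add 0) ?_
  have h := P_map_app (zetaHomog (of X)) (zero_add e₂) e₂_add_e₂ (zero_add e₂) e₂_add_e₂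
  rw [app_zetaHomog, sgn_one, neg_one_smul] at h
  have ξ_eq := ((A.family X).t_t (zero_add e₂) e₂_add_e₂).symm.trans h
  rw [app_evHomog, app_zetaHomog]
  exact (neg_eq_iff_eq_neg.2 ξ_eq).symm

lemma ev_beta (X : A.carrier) :
    ev (A.βQ.hom.app X) ≫ (sigma A (of (A.P.obj X))).hom ≫ (zeta A (of X)).hom =
      (zeta A (of (A.Q.functor.obj X))).hom ≫ (sigma A (of X)).hom := by
  have h₁ : -e₁ + e₂ + e₁ = e₂ := by abel
  have h₂ : e₂ + -e₁ = -e₁ + e₂ := add_comm _ _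
  have Q_zeta := Q_map_app (zetaHomog (of X)) (neg_add_cancel e₁) h₁ (zero_add e₂) rfl
  have P_sigma := P_map_app (sigmaHomog (of X)) (zero_add e₂) rfl (zero_add (-e₁)) h₂
  rw [app_zetaHomog] at Q_zeta
  rw [app_sigmaHomog, Prod.snd_neg, neg_zero, sgn_zero, one_smul] at P_sigma
  have β_Q_zeta := (congrArg (A.βQ.hom.app X ≫ ·) Q_zeta).symm.trans
    (((A.family X).s_t (neg_add_cancel e₁) h₁ (zero_add e₂) rfl).symm.trans P_sigma)
  have ev_sigma_eq : ev (A.βQ.hom.app X) ≫ (sigma A (of (A.P.obj X))).hom =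
      ofHomog (homComp (evHomog (A.βQ.hom.app X)) (sigmaHomog (of (A.P.obj X)))) :=
    ofHomog_comp _ _
  rw [← Category.assoc, ev_sigma_eq]
  refine ofHomog_comp_eq (g := zetaHomog (of X)) (f' := zetaHomog (of (A.Q.functor.obj X)))
    (g' := sigmaHomog (of X)) (b := -e₁) (by abel) rfl (zero_add e₂) h₂ ?_
  rw [app_homComp _ _ (zero_add 0) (zero_add (-e₁)), app_evHomog, app_sigmaHomog, app_zetaHomog]
  exact (Category.assoc _ _ _).trans β_Q_zeta

end Super

end Comparison

section OfStrict

variable {k : Type w} [CommRing k] {A B : QPCat.{w, v, u} k}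

/-- The `(Q, Π)`-functor given by a functor commuting strictly with all the structure. -/
def QPFunctor.ofStrict (F : A.carrier ⥤ B.carrier) [F.Additive] [F.Linear k]
    (hP : F ⋙ B.P = A.P ⋙ F) (hQ : F ⋙ B.Q.functor = A.Q.functor ⋙ F)
    (hξ : ∀ X, B.ξ.hom.app (F.obj X) =
      eqToHom ((congrArg B.P.obj (CategoryTheory.Functor.congr_obj hP X)).trans
        (CategoryTheory.Functor.congr_obj hP (A.P.obj X))) ≫ F.map (A.ξ.hom.app X))
    (hβ : ∀ X, B.βQ.hom.app (F.obj X) ≫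
        eqToHom ((congrArg B.Q.functor.obj (CategoryTheory.Functor.congr_obj hP X)).trans
          (CategoryTheory.Functor.congr_obj hQ (A.P.obj X))) =
      eqToHom ((congrArg B.P.obj (CategoryTheory.Functor.congr_obj hQ X)).trans
        (CategoryTheory.Functor.congr_obj hP (A.Q.functor.obj X))) ≫
          F.map (A.βQ.hom.app X)) : QPFunctor A B where
  functor := F
  additive := inferInstance
  linear := inferInstance
  β := eqToIso hP
  γ := eqToIso hQ
  β_ξ X := by
    rw [hξ, Category.assoc, ← F.map_comp, Iso.hom_inv_id_app]
    simp [eqToHom_map]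
  β_γ X := by
    have h := hβ X
    simp only [eqToIso.hom, eqToHom_app, eqToHom_map, eqToHom_trans, eqToHom_trans_assoc, h]

lemma QPFunctor.ofStrict_comp_ofStrict {F : A.carrier ⥤ B.carrier} [F.Additive] [F.Linear k]
    {G : B.carrier ⥤ A.carrier} [G.Additive] [G.Linear k] {hP hQ hξ hβ hP' hQ' hξ' hβ'}
    (h : F ⋙ G = 𝟭 _) : (ofStrict F hP hQ hξ hβ).comp (ofStrict G hP' hQ' hξ' hβ') =
      QPFunctor.id A := by
  refine QPFunctor.ext_of_app h (fun X => ?_) (fun X => ?_)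
  · simp only [QPFunctor.comp, ofStrict, NatIso.ofComponents_hom_app, Iso.trans_hom,
      Iso.app_hom, Functor.mapIso_hom, eqToIso.hom, eqToHom_app, eqToHom_map, eqToHom_trans]
    exact (eqToHom_trans _ _).trans ((eqToHom_map A.P _).symm.trans (Category.comp_id _).symm)
  · simp only [QPFunctor.comp, ofStrict, NatIso.ofComponents_hom_app, Iso.trans_hom,
      Iso.app_hom, Functor.mapIso_hom, eqToIso.hom, eqToHom_app, eqToHom_map, eqToHom_trans]
    exact (eqToHom_trans _ _).trans
      ((eqToHom_map A.Q.functor _).symm.trans (Category.comp_id _).symm)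

end OfStrict

section Comparison

variable {k : Type w} [CommRing k] {A : QPCat.{w, v, u} k} {X Y Z : A.carrier}

open Super

/-- An object of a `(Q, Π)`-category, viewed in the underlying category of the associated graded
supercategory. -/
abbrev toEDObj (X : A.carrier) : (E.obj (D A)).carrier := .of (.of X)

/-- The identification of the morphisms of a `(Q, Π)`-category with the even morphisms of degree
zero of the associated graded supercategory. -/
def evEquiv : (X ⟶ Y) ≃ₗ[k] (toEDObj X ⟶ toEDObj Y) :=
  LinearEquiv.ofBijective
    (LinearMap.codRestrict (homog k (of X) (of Y) 0) ev ev_mem :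
      (X ⟶ Y) →ₗ[k] (toEDObj X ⟶ toEDObj Y))
    ⟨fun _ _ h => ev_injective (congrArg Underlying.val h), fun f =>
      (exists_ev_eq (Underlying.val_mem f)).imp fun _ h => Underlying.hom_ext h⟩

lemma evEquiv_id (X : A.carrier) : evEquiv (𝟙 X) = 𝟙 (toEDObj X) :=
  Underlying.hom_ext (ev_id X)

lemma evEquiv_comp (f : X ⟶ Y) (g : Y ⟶ Z) : evEquiv (f ≫ g) = evEquiv f ≫ evEquiv g :=
  Underlying.hom_ext (ev_comp f g)

lemma P_map_evEquiv (f : X ⟶ Y) :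
    (E.obj (D A)).P.map (evEquiv f) = evEquiv (A.P.map f) :=
  Underlying.hom_ext ((cancel_mono ((D A).ζ (of Y)).hom).1
    ((map_ζ_even (D A) (ev_mem f)).trans (ev_zeta f).symm))

lemma Q_map_evEquiv (f : X ⟶ Y) :
    (E.obj (D A)).Q.functor.map (evEquiv f) = evEquiv (A.Q.functor.map f) :=
  Underlying.hom_ext ((cancel_mono ((D A).σ (of Y)).hom).1
    ((map_σ (D A) (ev f)).trans (ev_sigma f).symm))

lemma ξ_toEDObj (X : A.carrier) :
    (E.obj (D A)).ξ.hom.app (toEDObj X) = evEquiv (A.ξ.hom.app X) :=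
  Underlying.hom_ext ((xiIso_hom (D A) (of X)).trans (neg_eq_iff_eq_neg.2 (zeta_zeta X)))

lemma βQ_toEDObj (X : A.carrier) :
    (E.obj (D A)).βQ.hom.app (toEDObj X) = evEquiv (A.βQ.hom.app X) :=
  Underlying.hom_ext
    ((cancel_mono (((D A).σ ((D A).P.obj (of X))).hom ≫ ((D A).ζ (of X)).hom)).1
      ((betaIso_Q_comp (D A) (of X)).trans (ev_beta X).symm))

lemma P_map_evEquiv_symm (f : toEDObj X ⟶ toEDObj Y) :
    A.P.map (evEquiv.symm f) = evEquiv.symm ((E.obj (D A)).P.map f) := by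
  obtain ⟨f, rfl⟩ := evEquiv.surjective f
  rw [evEquiv.symm_apply_apply]
  exact ((congrArg evEquiv.symm (P_map_evEquiv f)).trans (evEquiv.symm_apply_apply _)).symm

lemma Q_map_evEquiv_symm (f : toEDObj X ⟶ toEDObj Y) :
    A.Q.functor.map (evEquiv.symm f) = evEquiv.symm ((E.obj (D A)).Q.functor.map f) := by
  obtain ⟨f, rfl⟩ := evEquiv.surjective f
  rw [evEquiv.symm_apply_apply]
  exact ((congrArg evEquiv.symm (Q_map_evEquiv f)).trans (evEquiv.symm_apply_apply _)).symm

lemma evEquiv_symm_comp (f : toEDObj X ⟶ toEDObj Y) (g : toEDObj Y ⟶ toEDObj Z) :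
    evEquiv.symm (f ≫ g) = evEquiv.symm f ≫ evEquiv.symm g := by
  rw [LinearEquiv.symm_apply_eq, evEquiv_comp, evEquiv.apply_symm_apply, evEquiv.apply_symm_apply]

variable (A)

/-- The comparison functor from a `(Q, Π)`-category to the underlying category of its graded
supercategory. -/
def toUnderlying : A.carrier ⥤ (E.obj (D A)).carrier where
  obj := toEDObj
  map := evEquiv
  map_id := evEquiv_id
  map_comp := evEquiv_comp

instance : (toUnderlying A).Additive := ⟨map_add evEquiv _ _⟩

instance : (toUnderlying A).Linear k := ⟨fun f r => map_smul evEquiv r f⟩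

/-- The inverse of the comparison functor. -/
def fromUnderlying : (E.obj (D A)).carrier ⥤ A.carrier where
  obj X := X.as.as
  map := evEquiv.symm
  map_id X := (LinearEquiv.symm_apply_eq _).2 (evEquiv_id X.as.as).symm
  map_comp := evEquiv_symm_comp

instance : (fromUnderlying A).Additive := ⟨map_add evEquiv.symm _ _⟩

instance : (fromUnderlying A).Linear k := ⟨fun f r => map_smul evEquiv.symm r f⟩

/-- The comparison `(Q, Π)`-functor. -/
def toED : QPFunctor A (E.obj (D A)) :=
  .ofStrict (toUnderlying A)
    (CategoryTheory.Functor.ext (fun _ => rfl) fun _ _ f =>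
      (P_map_evEquiv f).trans ((Category.id_comp _).trans (Category.comp_id _)).symm)
    (CategoryTheory.Functor.ext (fun _ => rfl) fun _ _ f =>
      (Q_map_evEquiv f).trans ((Category.id_comp _).trans (Category.comp_id _)).symm)
    (fun X => (ξ_toEDObj X).trans (Category.id_comp _).symm)
    (fun X => (Category.comp_id _).trans ((βQ_toEDObj X).trans (Category.id_comp _).symm))

/-- The inverse of the comparison `(Q, Π)`-functor. -/
def fromED : QPFunctor (E.obj (D A)) A :=
  .ofStrict (fromUnderlying A)
    (CategoryTheory.Functor.ext (fun _ => rfl) fun _ _ f =>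
      (P_map_evEquiv_symm f).trans ((Category.id_comp _).trans (Category.comp_id _)).symm)
    (CategoryTheory.Functor.ext (fun _ => rfl) fun _ _ f =>
      (Q_map_evEquiv_symm f).trans ((Category.id_comp _).trans (Category.comp_id _)).symm)
    (fun X => ((LinearEquiv.symm_apply_eq _).2 (ξ_toEDObj X.as.as)).symm.trans
      (Category.id_comp _).symm)
    (fun X => (Category.comp_id _).trans
      (((LinearEquiv.symm_apply_eq _).2 (βQ_toEDObj X.as.as)).symm.trans (Category.id_comp _).symm))

lemma toED_comp_fromED : (toED A).comp (fromED A) = QPFunctor.id A :=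
  QPFunctor.ofStrict_comp_ofStrict <|
    CategoryTheory.Functor.ext (fun _ => rfl) fun _ _ f => (evEquiv.symm_apply_apply f).trans
      ((Category.id_comp _).trans (Category.comp_id _)).symm

lemma fromED_comp_toED : (fromED A).comp (toED A) = QPFunctor.id (E.obj (D A)) :=
  QPFunctor.ofStrict_comp_ofStrict <|
    CategoryTheory.Functor.ext (fun _ => rfl) fun _ _ f => (evEquiv.apply_symm_apply f).trans
      ((Category.id_comp _).trans (Category.comp_id _)).symm

variable (k) in
instance E.essSurj_toFunctor : (E.{w, v, u} k).toFunctor.EssSurj where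
  mem_essImage A := ⟨D A, ⟨{
    hom := fromED A
    inv := toED A
    hom_inv_id := fromED_comp_toED A
    inv_hom_id := toED_comp_fromED A }⟩⟩

end Comparison

/-! ## Images of shift families -/

section Image

attribute [instance] QPFunctor.additive QPFunctor.linear

variable {k : Type w} [CommRing k] {A B : QPCat.{w, v, u} k}

namespace QPFunctor

open ShiftFamily

variable (F : QPFunctor A B)

/-- The image of a shift family under a `(Q, Π)`-functor. -/
def mapFamily (U : ShiftFamily A) : ShiftFamily B where
  obj a := F.functor.obj (U.obj a)
  s h := F.γ.app (U.obj _) ≪≫ F.functor.mapIso (U.s h)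
  t h := F.β.app (U.obj _) ≪≫ F.functor.mapIso (U.t h)
  t_t {a b} h h' := by
    have β_natural := F.β.hom.naturality (U.t h).hom
    have map_t_t := congrArg F.functor.map (U.t_t h h')
    have map_ξ := congrArg F.functor.map (A.ξ.inv_hom_id_app (U.obj a))
    simp only [Functor.comp_obj, Functor.comp_map, Functor.map_comp, Functor.id_obj]
      at β_natural map_t_t map_ξ
    simp only [Functor.comp_obj, Iso.trans_hom, Iso.app_hom, Functor.mapIso_hom, Functor.map_comp,
      Category.assoc]
    rw [reassoc_of% β_natural, ← reassoc_of% F.β_ξ (U.obj a), map_t_t, map_ξ]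
    simp
  s_t {a b a' b'} h h' l l' := by
    have β_natural := F.β.hom.naturality (U.s h).hom
    have β_γ := F.β_γ (U.obj a)
    have map_s_t := congrArg F.functor.map (U.s_t h h' l l')
    have γ_natural := F.γ.hom.naturality (U.t l).hom
    simp only [Functor.comp_obj, Functor.comp_map, Functor.map_comp]
      at β_natural β_γ map_s_t γ_natural
    simp only [Functor.comp_obj, Iso.trans_hom, Iso.app_hom, Functor.mapIso_hom, Functor.map_comp,
      Category.assoc]
    rw [reassoc_of% β_natural, map_s_t, reassoc_of% β_γ, reassoc_of% γ_natural]

/-- The image of a morphism of shift families under a `(Q, Π)`-functor. -/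
def mapHom {U V : ShiftFamily A} {i : Deg} :
    hom U V i →ₗ[k] hom (F.mapFamily U) (F.mapFamily V) i where
  toFun f := homMk (fun l => F.functor.map (app l f))
    (fun h h' l l' => by
      have γ_natural := F.γ.hom.naturality (app l f)
      have map_Q := congrArg F.functor.map (Q_map_app f h h' l l')
      simp only [Functor.comp_map, Functor.map_comp] at γ_natural map_Q
      simp [mapFamily, reassoc_of% γ_natural, map_Q])
    (fun h h' l l' => by
      have β_natural := F.β.hom.naturality (app l f)
      have map_P := congrArg F.functor.map (P_map_app f h h' l l')
      simp only [Functor.comp_map, Functor.map_comp, Functor.map_zsmul] at β_natural map_P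
      simp only [mapFamily, Iso.trans_hom, Iso.app_hom, Functor.mapIso_hom, Category.assoc,
        reassoc_of% β_natural, map_P, Preadditive.comp_zsmul]
      rfl)
  map_add' _ _ := Subtype.ext (funext fun _ => F.functor.map_add)
  map_smul' r _ := Subtype.ext (funext fun _ => F.functor.map_smul r _)

lemma app_mapHom {U V : ShiftFamily A} {i : Deg} (f : hom U V i) {a b : Deg} (h : a + i = b) :
    app h (F.mapHom f) = F.functor.map (app h f) := rfl

lemma mapHom_homId (U : ShiftFamily A) : F.mapHom (homId U) = homId (F.mapFamily U) :=
  hom_ext (zero_add 0) (F.functor.map_id (U.obj 0))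

lemma mapHom_homComp {U V W : ShiftFamily A} {i j : Deg} (f : hom U V i) (g : hom V W j) :
    F.mapHom (homComp f g) = homComp (F.mapHom f) (F.mapHom g) :=
  hom_ext (zero_add (i + j)) <| by
    have h : 0 + i + j = i + j := by rw [zero_add]
    rw [app_mapHom, app_homComp f g rfl h, app_homComp _ _ rfl h, F.functor.map_comp]
    rfl

end QPFunctor

end Image

/-! ## Trivializations of shift families in underlying categories -/

section Trivialization

variable {k : Type w} [CommRing k] {B : QPSupercat.{w, v, u} k}

lemma homog_congr {C : Type u} [Category.{v} C] [Preadditive C] [Linear k C]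
    [GradedSupercategory k C] {X Y : C} {i j : Deg} (h : i = j) {f : X ⟶ Y}
    (hf : f ∈ homog k X Y i) : f ∈ homog k X Y j := h ▸ hf

/-- An isomorphism multiplied by the sign of a parity. -/
def sgnIso {C : Type u} [Category.{v} C] [Preadditive C] (p : ZMod 2) {X Y : C} (e : X ≅ Y) :
    X ≅ Y where
  hom := sgn p • e.hom
  inv := sgn p • e.inv
  hom_inv_id := by simp [smul_smul, sgn_mul_self]
  inv_hom_id := by simp [smul_smul, sgn_mul_self]

namespace E

/-- An object of the underlying category, viewed in the graded supercategory. -/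
abbrev as (X : (E.obj B).carrier) : B.carrier := Underlying.as X

/-- An object of the graded supercategory, viewed in the underlying category. -/
abbrev of (X : B.carrier) : (E.obj B).carrier := Underlying.of X

variable {X Y Z : (E.obj B).carrier}

/-- The inclusion of the morphisms of the underlying category into those of the graded
supercategory. -/
def val : (X ⟶ Y) →ₗ[k] (as X ⟶ as Y) := (homog k (as X) (as Y) 0).subtype

/-- An even morphism of degree zero, viewed in the underlying category. -/
def mk (f : as X ⟶ as Y) (hf : f ∈ homog k (as X) (as Y) 0) : X ⟶ Y :=
  Underlying.mk f hf

lemma val_mem (f : X ⟶ Y) : val f ∈ homog k (as X) (as Y) 0 := Underlying.val_mem f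

lemma val_comp (f : X ⟶ Y) (g : Y ⟶ Z) : val (f ≫ g) = val f ≫ val g := rfl

lemma hom_ext {f g : X ⟶ Y} (h : val f = val g) : f = g := Underlying.hom_ext h

/-- The isomorphism of the graded supercategory given by an isomorphism of its underlying
category. -/
def valIso (e : X ≅ Y) : as X ≅ as Y where
  hom := val e.hom
  inv := val e.inv
  hom_inv_id := congrArg val e.hom_inv_id
  inv_hom_id := congrArg val e.inv_hom_id

end E

namespace ShiftFamily

variable (U V : ShiftFamily (E.obj B))

/-- The objects of the graded supercategory in a shift family of its underlying category. -/
abbrev objVal (a : Deg) : B.carrier := E.as (U.obj a)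

/-- The isomorphisms `Q U_a ≅ U_b` of a shift family, in the graded supercategory. -/
def sVal {a b : Deg} (h : b + e₁ = a) : B.Q.obj (U.objVal a) ≅ U.objVal b :=
  E.valIso (U.s h)

/-- The isomorphisms `Π U_a ≅ U_b` of a shift family, in the graded supercategory. -/
def tVal {a b : Deg} (h : a + e₂ = b) : B.P.obj (U.objVal a) ≅ U.objVal b :=
  E.valIso (U.t h)

lemma sVal_mem {a b : Deg} (h : b + e₁ = a) :
    (U.sVal h).hom ∈ homog k (B.Q.obj (U.objVal a)) (U.objVal b) 0 :=
  E.val_mem (U.s h).hom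

lemma tVal_mem {a b : Deg} (h : a + e₂ = b) :
    (U.tVal h).hom ∈ homog k (B.P.obj (U.objVal a)) (U.objVal b) 0 :=
  E.val_mem (U.t h).hom

lemma sVal_inv_mem {a b : Deg} (h : b + e₁ = a) :
    (U.sVal h).inv ∈ homog k (U.objVal b) (B.Q.obj (U.objVal a)) 0 :=
  E.val_mem (U.s h).inv

lemma tVal_inv_mem {a b : Deg} (h : a + e₂ = b) :
    (U.tVal h).inv ∈ homog k (U.objVal b) (B.P.obj (U.objVal a)) 0 :=
  E.val_mem (U.t h).inv

lemma tVal_tVal {a b : Deg} (h : a + e₂ = b) (h' : b + e₂ = a) :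
    B.P.map (U.tVal h).hom ≫ (U.tVal h').hom = (xiIso B (U.objVal a)).hom :=
  congrArg E.val (U.t_t h h')

lemma sVal_tVal {a b a' b' : Deg} (h : b + e₁ = a) (h' : b' + e₁ = a') (l : a + e₂ = a')
    (l' : b + e₂ = b') : B.P.map (U.sVal h).hom ≫ (U.tVal l').hom =
      (betaIso B.Q (U.objVal a)).hom ≫ B.Q.map (U.tVal l).hom ≫ (U.sVal h').hom :=
  congrArg E.val (U.s_t h h' l l')

/-- The isomorphisms of the `a`-th object of a shift family with a given object that are homogeneous
of bidegree `a`. -/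
abbrev HomogIso (Y : B.carrier) (a : Deg) : Type v :=
  {c : U.objVal a ≅ Y // c.hom ∈ homog k (U.objVal a) Y a}

variable {Y : B.carrier}

/-- The transport of homogeneous isomorphisms along `s` and `σ`. -/
def homogIsoQ {a b : Deg} (h : b + e₁ = a) : U.HomogIso Y a ≃ U.HomogIso Y b where
  toFun c := ⟨(U.sVal h).symm ≪≫ B.σ _ ≪≫ c.1, homog_congr
    (show 0 + (-e₁ + a) = b by rw [← h]; abel)
    (GradedSupercategory.comp_mem (U.sVal_inv_mem h)
      (GradedSupercategory.comp_mem (B.hσ.mem _) c.2))⟩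
  invFun c := ⟨(B.σ _).symm ≪≫ U.sVal h ≪≫ c.1, homog_congr
    (show - -e₁ + (0 + b) = a by rw [← h]; abel)
    (GradedSupercategory.comp_mem (inv_mem _ (B.hσ.mem _))
      (GradedSupercategory.comp_mem (U.sVal_mem h) c.2))⟩
  left_inv c := Subtype.ext (Iso.ext (by simp))
  right_inv c := Subtype.ext (Iso.ext (by simp))

/-- The transport of homogeneous isomorphisms along `t` and `ζ`. -/
def homogIsoP {a b : Deg} (h : a + e₂ = b) (c : U.HomogIso Y a) : U.HomogIso Y b :=
  ⟨sgnIso a.2 ((U.tVal h).symm ≪≫ B.ζ _ ≪≫ c.1), zsmul_mem (homog_congr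
    (show 0 + (e₂ + a) = b by rw [← h]; abel)
    (GradedSupercategory.comp_mem (U.tVal_inv_mem h)
      (GradedSupercategory.comp_mem (B.hζ.mem _) c.2))) _⟩

lemma homogIsoP_homogIsoP {a b : Deg} (h : a + e₂ = b) (h' : b + e₂ = a) (c : U.HomogIso Y a) :
    U.homogIsoP h' (U.homogIsoP h c) = c := Subtype.ext (Iso.ext (by
  have t_t := U.tVal_tVal h h'
  have t_natural := map_ζ_even B (U.tVal_mem h)
  have sgn_ba : sgn b.2 * sgn a.2 = -1 := by rw [sgn_of_add_e₂ h, neg_mul, sgn_mul_self]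
  rw [xiIso_hom] at t_t
  rw [← cancel_epi (U.tVal h').hom, ← cancel_epi (B.P.map (U.tVal h).hom)]
  simp [homogIsoP, sgnIso, smul_smul, sgn_ba, reassoc_of% t_t, reassoc_of% t_natural]))

lemma homogIsoQ_homogIsoP {a b a' b' : Deg} (h : b + e₁ = a) (h' : b' + e₁ = a')
    (l : a + e₂ = a') (l' : b + e₂ = b') (c : U.HomogIso Y a) :
    U.homogIsoQ h' (U.homogIsoP l c) = U.homogIsoP l' (U.homogIsoQ h c) :=
  Subtype.ext (Iso.ext (by
    have s_t := U.sVal_tVal h h' l l'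
    have s_natural := map_ζ_even B (U.sVal_mem h)
    have β_σ_ζ := betaIso_Q_comp B (U.objVal a)
    have parity_eq : a.2 = b.2 := by simp [← h]
    rw [← cancel_epi (U.tVal l').hom, ← cancel_epi (B.P.map (U.sVal h).hom), reassoc_of% s_t]
    simp [homogIsoP, homogIsoQ, sgnIso, parity_eq, map_σ_assoc, reassoc_of% s_natural,
      reassoc_of% β_σ_ζ]))

/-- A trivialization of a shift family in an underlying category: isomorphisms with a given object,
homogeneous of the bidegree given by the index, which identify `s` with `σ` and `t` with `ζ` up to
sign. -/
structure Trivialization (U : ShiftFamily (E.obj B)) (Y : B.carrier) where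
  /-- The isomorphism of the `a`-th object of the family with the given object. -/
  iso : ∀ a, U.objVal a ≅ Y
  mem : ∀ a, (iso a).hom ∈ homog k (U.objVal a) Y a
  s_comp : ∀ {a b : Deg} (h : b + e₁ = a),
    (U.sVal h).hom ≫ (iso b).hom = (B.σ _).hom ≫ (iso a).hom
  t_comp : ∀ {a b : Deg} (h : a + e₂ = b),
    (U.tVal h).hom ≫ (iso b).hom = sgn a.2 • ((B.ζ _).hom ≫ (iso a).hom)

namespace Trivialization

variable {U V} {X : B.carrier}

lemma exists_iso_zero_eq (c₀ : U.objVal 0 ≅ Y) (hc₀ : c₀.hom ∈ homog k (U.objVal 0) Y 0) :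
    ∃ c : Trivialization U Y, c.iso 0 = c₀ := by
  obtain ⟨c, hc₀, hQ, hP⟩ := exists_descent (P := U.HomogIso Y) U.homogIsoQ U.homogIsoP
    U.homogIsoP_homogIsoP U.homogIsoQ_homogIsoP ⟨c₀, hc₀⟩
  refine ⟨⟨fun a => (c a).1, fun a => (c a).2, fun h => ?_, fun h => ?_⟩,
    congrArg Subtype.val hc₀⟩
  · rw [← hQ h]; simp [homogIsoQ]
  · rw [← hP h]; simp [homogIsoP, sgnIso]

variable (c : Trivialization U X) (d : Trivialization V Y) {i : Deg}

lemma conj_mem {f : X ⟶ Y} (hf : f ∈ homog k X Y i) {a b : Deg} (h : a + i = b) :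
    (c.iso a).hom ≫ f ≫ (d.iso b).inv ∈ homog k (U.objVal a) (V.objVal b) 0 :=
  homog_congr (by rw [← h]; abel) (GradedSupercategory.comp_mem (c.mem a)
    (GradedSupercategory.comp_mem hf (inv_mem _ (d.mem b))))

lemma conj_symm_mem (g : U.obj 0 ⟶ V.obj i) :
    (c.iso 0).inv ≫ E.val g ≫ (d.iso i).hom ∈ homog k X Y i :=
  homog_congr (by simp) (GradedSupercategory.comp_mem (inv_mem _ (c.mem 0))
    (GradedSupercategory.comp_mem (E.val_mem g) (d.mem i)))

lemma Q_map_conj (f : X ⟶ Y) {a b a' b' : Deg} (h : b + e₁ = a) (h' : b' + e₁ = a') :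
    B.Q.map ((c.iso a).hom ≫ f ≫ (d.iso a').inv) ≫ (V.sVal h').hom =
      (U.sVal h).hom ≫ (c.iso b).hom ≫ f ≫ (d.iso b').inv := by
  rw [← cancel_mono (d.iso b').hom, Category.assoc, d.s_comp h', map_σ_assoc]
  simp [reassoc_of% c.s_comp h]

lemma P_map_conj {f : X ⟶ Y} (hf : f ∈ homog k X Y i) {a b a' b' : Deg} (h : a + e₂ = b)
    (h' : a' + e₂ = b') (l : a + i = a') :
    B.P.map ((c.iso a).hom ≫ f ≫ (d.iso a').inv) ≫ (V.tVal h').hom =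
      sgn i.2 • ((U.tVal h).hom ≫ (c.iso b).hom ≫ f ≫ (d.iso b').inv) := by
  rw [← cancel_mono (d.iso b').hom, Category.assoc, d.t_comp h', Preadditive.comp_zsmul,
    reassoc_of% map_ζ_even B (c.conj_mem d hf l), Preadditive.zsmul_comp]
  simp [reassoc_of% c.t_comp h, smul_smul, ← l, sgn_add, mul_comm]

/-- The matrix of a homogeneous morphism with respect to trivializations of shift families. -/
def matrix : homog k X Y i ≃ₗ[k] hom U V i where
  toFun f := homMk (fun h => E.mk _ (c.conj_mem d f.2 h))
    (fun h h' _ _ => E.hom_ext (c.Q_map_conj d f.1 h h'))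
    (fun {_ b _ b'} h h' l l' => E.hom_ext ((c.P_map_conj d f.2 h h' l).trans
      (map_zsmul E.val _ ((U.t h).hom ≫ E.mk (Y := V.obj b') _ (c.conj_mem d f.2 l'))).symm))
  map_add' f g := hom_ext (zero_add i) <| E.hom_ext <|
    show (c.iso 0).hom ≫ (f.1 + g.1) ≫ (d.iso i).inv =
      (c.iso 0).hom ≫ f.1 ≫ (d.iso i).inv + (c.iso 0).hom ≫ g.1 ≫ (d.iso i).inv by simp
  map_smul' r f := hom_ext (zero_add i) <| E.hom_ext <|
    show (c.iso 0).hom ≫ (r • f.1) ≫ (d.iso i).inv =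
      r • ((c.iso 0).hom ≫ f.1 ≫ (d.iso i).inv) by simp
  invFun g := ⟨_, c.conj_symm_mem d (app (zero_add i) g)⟩
  left_inv f := Subtype.ext <|
    show (c.iso 0).inv ≫ ((c.iso 0).hom ≫ f.1 ≫ (d.iso i).inv) ≫ (d.iso i).hom = f.1 by simp
  right_inv g := hom_ext (zero_add i) <| E.hom_ext <|
    show (c.iso 0).hom ≫ ((c.iso 0).inv ≫ E.val (app (zero_add i) g) ≫ (d.iso i).hom) ≫
      (d.iso i).inv = E.val (app (zero_add i) g) by simp

lemma val_app_matrix (f : homog k X Y i) {a b : Deg} (h : a + i = b) :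
    E.val (app h (matrix c d f)) = (c.iso a).hom ≫ f.1 ≫ (d.iso b).inv := rfl

lemma matrix_id : matrix c c ⟨𝟙 X, GradedSupercategory.id_mem X⟩ = homId U :=
  hom_ext (zero_add 0) <| E.hom_ext <|
    show (c.iso 0).hom ≫ 𝟙 X ≫ (c.iso 0).inv = 𝟙 (U.objVal 0) by simp

lemma matrix_comp {W : ShiftFamily (E.obj B)} {Z : B.carrier} (e : Trivialization W Z) {j : Deg}
    (f : homog k X Y i) (g : homog k Y Z j) :
    matrix c e ⟨f.1 ≫ g.1, GradedSupercategory.comp_mem f.2 g.2⟩ =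
      homComp (matrix c d f) (matrix d e g) :=
  hom_ext (zero_add _) <| E.hom_ext <|
    show (c.iso 0).hom ≫ (f.1 ≫ g.1) ≫ (e.iso (i + j)).inv =
      ((c.iso 0).hom ≫ f.1 ≫ (d.iso (0 + i)).inv) ≫
        (d.iso (0 + i)).hom ≫ g.1 ≫ (e.iso (i + j)).inv by simp

end Trivialization

end ShiftFamily

end Trivialization

/-! ## Lifting `(Q, Π)`-functors between underlying categories -/

section Lift

variable {k : Type w} [CommRing k] {A B : QPSupercat.{w, v, u} k}

open ShiftFamily

/-- The shift family of an object of a graded `(Q, Π)`-supercategory in the underlying category. -/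
abbrev fam (X : A.carrier) : ShiftFamily (E.obj A) := (E.obj A).family (E.of X)

/-- The trivialization of the shift family of an object that is the identity at index `0`. -/
def famTriv (X : A.carrier) : Trivialization (fam X) X :=
  (Trivialization.exists_iso_zero_eq (U := fam X) (E.valIso ((E.obj A).familyZero (E.of X)))
    (E.val_mem _)).choose

lemma famTriv_iso_zero (X : A.carrier) :
    (famTriv X).iso 0 = E.valIso ((E.obj A).familyZero (E.of X)) :=
  (Trivialization.exists_iso_zero_eq (U := fam X) _ (E.val_mem _)).choose_spec

variable (F : QPFunctor (E.obj A) (E.obj B))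

/-- The trivialization of the image of the shift family of an object that is the identity at
index `0`. -/
def imgTriv (X : A.carrier) :
    Trivialization (F.mapFamily (fam X)) (E.as (F.functor.obj (E.of X))) :=
  (Trivialization.exists_iso_zero_eq (U := F.mapFamily (fam X))
    (E.valIso (F.functor.mapIso ((E.obj A).familyZero (E.of X)))) (E.val_mem _)).choose

lemma imgTriv_iso_zero (X : A.carrier) : (imgTriv F X).iso 0 =
    E.valIso (F.functor.mapIso ((E.obj A).familyZero (E.of X))) :=
  (Trivialization.exists_iso_zero_eq (U := F.mapFamily (fam X)) _ (E.val_mem _)).choose_spec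

/-- The action of a `(Q, Π)`-functor between underlying categories on the homogeneous morphisms of
the graded supercategories, through their matrices. -/
def liftHomog (X Y : A.carrier) (i : Deg) : homog k X Y i →ₗ[k]
    homog k (E.as (F.functor.obj (E.of X))) (E.as (F.functor.obj (E.of Y))) i :=
  ((imgTriv F X).matrix (imgTriv F Y)).symm.toLinearMap ∘ₗ F.mapHom ∘ₗ
    ((famTriv X).matrix (famTriv Y)).toLinearMap

lemma matrix_liftHomog {X Y : A.carrier} {i : Deg} (f : homog k X Y i) :
    (imgTriv F X).matrix (imgTriv F Y) (liftHomog F X Y i f) =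
      F.mapHom ((famTriv X).matrix (famTriv Y) f) :=
  LinearEquiv.apply_symm_apply _ _

lemma liftHomog_id (X : A.carrier) :
    liftHomog F X X 0 ⟨𝟙 X, GradedSupercategory.id_mem X⟩ =
      ⟨𝟙 (E.as (F.functor.obj (E.of X))), GradedSupercategory.id_mem _⟩ := by
  rw [← ((imgTriv F X).matrix (imgTriv F X)).injective.eq_iff, matrix_liftHomog,
    Trivialization.matrix_id, Trivialization.matrix_id, F.mapHom_homId]

lemma liftHomog_comp {X Y Z : A.carrier} {i j : Deg} (f : homog k X Y i) (g : homog k Y Z j) :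
    liftHomog F X Z (i + j) ⟨f.1 ≫ g.1, GradedSupercategory.comp_mem f.2 g.2⟩ =
      ⟨(liftHomog F X Y i f).1 ≫ (liftHomog F Y Z j g).1,
        GradedSupercategory.comp_mem (liftHomog F X Y i f).2 (liftHomog F Y Z j g).2⟩ := by
  rw [← ((imgTriv F X).matrix (imgTriv F Z)).injective.eq_iff, matrix_liftHomog,
    Trivialization.matrix_comp _ (famTriv Y), Trivialization.matrix_comp _ (imgTriv F Y),
    matrix_liftHomog, matrix_liftHomog, F.mapHom_homComp]

/-- The graded superfunctor given by a `(Q, Π)`-functor between underlying categories. -/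
def lift : GSFunctor A B where
  functor := functorOfHomog (fun X => E.as (F.functor.obj (E.of X)))
    (fun X Y i => (homog k _ _ i).subtype ∘ₗ liftHomog F X Y i)
    (fun X => congrArg Subtype.val (liftHomog_id F X))
    (fun f hf g hg => congrArg Subtype.val (liftHomog_comp F ⟨f, hf⟩ ⟨g, hg⟩))
  isSuper := isGradedSuperfunctor_functorOfHomog fun X Y i f => (liftHomog F X Y i f).2

lemma lift_map {X Y : A.carrier} {i : Deg} {f : X ⟶ Y} (hf : f ∈ homog k X Y i) :
    (lift F).functor.map f = (liftHomog F X Y i ⟨f, hf⟩).1 :=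
  functorOfHomog_map (hid := fun X => congrArg Subtype.val (liftHomog_id F X))
    (hcomp := fun f hf g hg => congrArg Subtype.val (liftHomog_comp F ⟨f, hf⟩ ⟨g, hg⟩)) hf

lemma val_map_comp_imgTriv {X Y : A.carrier} {i : Deg} {f : X ⟶ Y} (hf : f ∈ homog k X Y i)
    {a b : Deg} (h : a + i = b) {g : (fam X).obj a ⟶ (fam Y).obj b}
    (hg : E.val g ≫ ((famTriv Y).iso b).hom = ((famTriv X).iso a).hom ≫ f) :
    E.val (F.functor.map g) ≫ ((imgTriv F Y).iso b).hom =
      ((imgTriv F X).iso a).hom ≫ (lift F).functor.map f := by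
  have g_eq : g = app h ((famTriv X).matrix (famTriv Y) ⟨f, hf⟩) :=
    E.hom_ext <| by
      rw [Trivialization.val_app_matrix, ← Category.assoc, Iso.eq_comp_inv, hg]
  have map_g : E.val (F.functor.map g) =
      (((imgTriv F X).iso a).hom ≫ (lift F).functor.map f) ≫ ((imgTriv F Y).iso b).inv := by
    rw [g_eq, ← F.app_mapHom, ← matrix_liftHomog, lift_map F hf]
    exact (Category.assoc _ _ _).symm
  exact (Iso.eq_comp_inv ((imgTriv F Y).iso b)).1 map_g

lemma lift_map_val {X Y : (E.obj A).carrier} (f : X ⟶ Y) :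
    (lift F).functor.map (E.val f) = E.val (F.functor.map f) := by
  let e := (E.obj A).familyZero
  have conj_comp : ((e X).hom ≫ f ≫ (e Y).inv) ≫ (e Y).hom = (e X).hom ≫ f := by simp
  have val_conj_comp : E.val ((e X).hom ≫ f ≫ (e Y).inv) ≫ ((famTriv (E.as Y)).iso 0).hom =
      ((famTriv (E.as X)).iso 0).hom ≫ E.val f := by
    rw [famTriv_iso_zero, famTriv_iso_zero]
    exact congrArg E.val conj_comp
  have val_map_conj_comp := val_map_comp_imgTriv F (E.val_mem f) (add_zero 0) val_conj_comp
  rw [imgTriv_iso_zero, imgTriv_iso_zero] at val_map_conj_comp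
  have val_map_comp : E.val (F.functor.map (e X).hom) ≫ E.val (F.functor.map f) =
      E.val (F.functor.map ((e X).hom ≫ f ≫ (e Y).inv)) ≫ E.val (F.functor.map (e Y).hom) := by
    rw [← E.val_comp, ← E.val_comp, ← F.functor.map_comp, ← F.functor.map_comp, conj_comp]
  exact ((cancel_epi (E.valIso (F.functor.mapIso (e X))).hom).1
    (val_map_comp.trans val_map_conj_comp)).symm

lemma lift_map_famTriv_iso (X : A.carrier) (a : Deg) :
    (lift F).functor.map ((famTriv X).iso a).hom = ((imgTriv F X).iso a).hom := by
  let e := (E.obj A).familyZero ((fam X).obj a)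
  have val_e_comp : E.val e.hom ≫ ((famTriv X).iso a).hom =
      ((famTriv ((fam X).objVal a)).iso 0).hom ≫ ((famTriv X).iso a).hom := by
    rw [famTriv_iso_zero]
    rfl
  have val_map_e_comp := val_map_comp_imgTriv F ((famTriv X).mem a) (zero_add a) val_e_comp
  rw [imgTriv_iso_zero] at val_map_e_comp
  exact ((cancel_epi (E.valIso (F.functor.mapIso e)).hom).1 val_map_e_comp).symm

/-- The isomorphism `β_F` of a `(Q, Π)`-functor, in the graded supercategory. -/
def βVal (X : A.carrier) : B.P.obj ((lift F).functor.obj X) ⟶ (lift F).functor.obj (A.P.obj X) :=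
  E.val (F.β.hom.app (E.of X))

/-- The isomorphism `γ_F` of a `(Q, Π)`-functor, in the graded supercategory. -/
def γVal (X : A.carrier) : B.Q.obj ((lift F).functor.obj X) ⟶ (lift F).functor.obj (A.Q.obj X) :=
  E.val (F.γ.hom.app (E.of X))

lemma βVal_comp_map_ζ (X : A.carrier) : βVal F X ≫ (lift F).functor.map (A.ζ X).hom =
    (B.ζ ((lift F).functor.obj X)).hom := by
  have t_comp : ((fam X).tVal (zero_add e₂)).hom ≫ ((famTriv X).iso e₂).hom =
      (A.ζ ((fam X).objVal 0)).hom ≫ ((famTriv X).iso 0).hom :=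
    ((famTriv X).t_comp (zero_add e₂)).trans (one_smul _ _)
  have img_t_comp : βVal F ((fam X).objVal 0) ≫
      (lift F).functor.map ((fam X).tVal (zero_add e₂)).hom ≫
        (lift F).functor.map ((famTriv X).iso e₂).hom =
      (B.ζ ((lift F).functor.obj ((fam X).objVal 0))).hom ≫
        (lift F).functor.map ((famTriv X).iso 0).hom := by
    rw [lift_map_famTriv_iso, lift_map_famTriv_iso]
    refine (congrArg (fun f => _ ≫ f ≫ _) (lift_map_val F ((fam X).t (zero_add e₂)).hom)).trans ?_
    exact (Category.assoc _ _ _).symm.trans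
      (((imgTriv F X).t_comp (zero_add e₂)).trans (one_smul _ _))
  rw [← Functor.map_comp, t_comp, Functor.map_comp, ← Category.assoc, cancel_mono] at img_t_comp
  exact img_t_comp

lemma γVal_comp_map_σ (X : A.carrier) : γVal F X ≫ (lift F).functor.map (A.σ X).hom =
    (B.σ ((lift F).functor.obj X)).hom := by
  have img_s_comp : γVal F ((fam X).objVal 0) ≫
      (lift F).functor.map ((fam X).sVal (neg_add_cancel e₁)).hom ≫
        (lift F).functor.map ((famTriv X).iso (-e₁)).hom =
      (B.σ ((lift F).functor.obj ((fam X).objVal 0))).hom ≫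
        (lift F).functor.map ((famTriv X).iso 0).hom := by
    rw [lift_map_famTriv_iso, lift_map_famTriv_iso]
    refine (congrArg (fun f => _ ≫ f ≫ _)
      (lift_map_val F ((fam X).s (neg_add_cancel e₁)).hom)).trans ?_
    exact (Category.assoc _ _ _).symm.trans ((imgTriv F X).s_comp (neg_add_cancel e₁))
  rw [← Functor.map_comp, (famTriv X).s_comp, Functor.map_comp, ← Category.assoc,
    cancel_mono] at img_s_comp
  exact img_s_comp

lemma betaIso_lift (X : A.carrier) :
    (betaIso (lift F).functor X).hom = βVal F X :=
  (betaIso_hom (lift F).isSuper X).trans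
    ((Iso.comp_inv_eq ((lift F).functor.mapIso (A.ζ X))).2 (βVal_comp_map_ζ F X).symm)

lemma gammaIso_lift (X : A.carrier) :
    (gammaIso (lift F).functor X).hom = γVal F X :=
  (gammaIso_hom X).trans
    ((Iso.comp_inv_eq ((lift F).functor.mapIso (A.σ X))).2 (γVal_comp_map_σ F X).symm)

lemma map_lift : E.map (lift F) = F :=
  QPFunctor.ext_of_heq (CategoryTheory.Functor.ext (fun _ => rfl) fun _ _ f =>
    (E.hom_ext (f := (E.map (lift F)).functor.map f) (g := F.functor.map f)
      (lift_map_val F f)).trans ((Category.id_comp _).trans (Category.comp_id _)).symm)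
    (fun X => heq_of_eq (E.hom_ext (X := (E.obj B).P.obj (F.functor.obj X))
      (Y := F.functor.obj ((E.obj A).P.obj X)) (betaIso_lift F (E.as X))))
    (fun X => heq_of_eq (E.hom_ext (X := (E.obj B).Q.functor.obj (F.functor.obj X))
      (Y := F.functor.obj ((E.obj A).Q.functor.obj X)) (gammaIso_lift F (E.as X))))

variable (k) in
instance E.full_toFunctor : (E.{w, v, u} k).toFunctor.Full where
  map_surjective F := ⟨lift F, map_lift F⟩

end Lift

/-! ## Graded `(Q, Π)`-supercategories are generated by even morphisms of degree zero, `ζ`, `σ` -/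

section Generation

variable {k : Type w} [CommRing k] {A B : QPSupercat.{w, v, u} k}

open ShiftFamily

/-- A property of morphisms of a graded `(Q, Π)`-supercategory that holds for the generators, which
are the even morphisms of degree zero, `ζ` and `σ`, and is stable under sums, composition and
inversion. Such a property holds for all morphisms. -/
structure IsGeneratorClosed (P : MorphismProperty A.carrier) : Prop where
  even : ∀ {X Y : A.carrier} {f : X ⟶ Y}, f ∈ homog k X Y 0 → P f
  ζ : ∀ X : A.carrier, P (A.ζ X).hom
  σ : ∀ X : A.carrier, P (A.σ X).hom
  add : ∀ {X Y : A.carrier} {f g : X ⟶ Y}, P f → P g → P (f + g)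
  comp : ∀ {X Y Z : A.carrier} {f : X ⟶ Y} {g : Y ⟶ Z}, P f → P g → P (f ≫ g)
  inv : P.StableUnderInverse

namespace IsGeneratorClosed

variable {P : MorphismProperty A.carrier} (hP : IsGeneratorClosed P)
include hP

lemma famTriv_iso (Y : A.carrier) : ∀ a, P ((famTriv Y).iso a).hom := by
  refine deg_induction (hP.even ((famTriv Y).mem 0))
    (fun {a b} h => ⟨fun hb => ?_, fun ha => ?_⟩) (fun {a b} h ha => ?_)
  · rw [(Iso.eq_inv_comp _).2 ((famTriv Y).s_comp h)]
    exact hP.comp (hP.inv _ (hP.even ((fam Y).sVal_mem h))) (hP.comp (hP.σ _) hb)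
  · rw [(Iso.eq_inv_comp _).2 ((famTriv Y).s_comp h).symm]
    exact hP.comp (hP.inv _ (hP.σ _)) (hP.comp (hP.even ((fam Y).sVal_mem h)) ha)
  · rw [(Iso.eq_inv_comp _).2 ((famTriv Y).t_comp h), Preadditive.comp_zsmul,
      ← Preadditive.zsmul_comp]
    exact hP.comp (hP.even (zsmul_mem ((fam Y).tVal_inv_mem h) _)) (hP.comp (hP.ζ _) ha)

lemma of_mem_homog {X Y : A.carrier} {i : Deg} {f : X ⟶ Y} (hf : f ∈ homog k X Y i) : P f := by
  have comp_inv_mem : f ≫ ((famTriv Y).iso i).inv ∈ homog k X ((fam Y).objVal i) 0 :=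
    homog_congr (add_neg_cancel i)
      (GradedSupercategory.comp_mem hf (inv_mem _ ((famTriv Y).mem i)))
  rw [← Category.comp_id f, ← ((famTriv Y).iso i).inv_hom_id, ← Category.assoc]
  exact hP.comp (hP.even comp_inv_mem) (hP.famTriv_iso Y i)

lemma of_hom {X Y : A.carrier} (f : X ⟶ Y) : P f :=
  hom_induction (k := k) (P := fun f => P f) (hP.even (zero_mem _)) (fun _ _ => hP.add)
    (fun _ _ => hP.of_mem_homog) f

end IsGeneratorClosed

variable {F G : GSFunctor A B}

/-- The components of a `(Q, Π)`-natural transformation between restrictions of graded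
superfunctors. -/
def transVal (x : QPTrans (E.map F) (E.map G)) (X : A.carrier) :
    F.functor.obj X ⟶ G.functor.obj X :=
  E.val (x.trans.app (E.of X))

lemma transVal_mem (x : QPTrans (E.map F) (E.map G)) (X : A.carrier) :
    transVal x X ∈ homog k _ _ 0 :=
  E.val_mem (x.trans.app (E.of X))

lemma transVal_naturality_ζ (x : QPTrans (E.map F) (E.map G)) (X : A.carrier) :
    F.functor.map (A.ζ X).inv ≫ transVal x (A.P.obj X) =
      transVal x X ≫ G.functor.map (A.ζ X).inv := by
  have comm_β : (betaIso F.functor X).hom ≫ transVal x (A.P.obj X) =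
      B.P.map (transVal x X) ≫ (betaIso G.functor X).hom := congrArg E.val (x.comm_β (E.of X))
  rw [betaIso_hom F.isSuper, betaIso_hom G.isSuper, ← Category.assoc,
    map_ζ_even B (transVal_mem x X), Category.assoc, Category.assoc, cancel_epi] at comm_β
  exact comm_β

lemma transVal_naturality_σ (x : QPTrans (E.map F) (E.map G)) (X : A.carrier) :
    F.functor.map (A.σ X).inv ≫ transVal x (A.Q.obj X) =
      transVal x X ≫ G.functor.map (A.σ X).inv := by
  have comm_γ : (gammaIso F.functor X).hom ≫ transVal x (A.Q.obj X) =
      B.Q.map (transVal x X) ≫ (gammaIso G.functor X).hom := congrArg E.val (x.comm_γ (E.of X))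
  rw [gammaIso_hom, gammaIso_hom, map_σ_assoc, Category.assoc, cancel_epi] at comm_γ
  exact comm_γ

lemma isGeneratorClosed_naturalityProperty (x : QPTrans (E.map F) (E.map G)) :
    IsGeneratorClosed (MorphismProperty.naturalityProperty (transVal x)) where
  even {X Y} f hf := congrArg E.val
    (x.trans.naturality (E.mk (X := E.of X) (Y := E.of Y) f hf))
  ζ X := MorphismProperty.naturalityProperty.stableUnderInverse (transVal x) (A.ζ X).symm
    (transVal_naturality_ζ x X)
  σ X := MorphismProperty.naturalityProperty.stableUnderInverse (transVal x) (A.σ X).symm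
    (transVal_naturality_σ x X)
  add {X Y f g} hf hg := by
    have := F.isSuper.additive
    have := G.isSuper.additive
    unfold MorphismProperty.naturalityProperty at hf hg ⊢
    rw [Functor.map_add, Functor.map_add, Preadditive.add_comp, Preadditive.comp_add, hf, hg]
  comp hf hg := MorphismProperty.comp_mem _ _ _ hf hg
  inv := MorphismProperty.naturalityProperty.stableUnderInverse (transVal x)

lemma transVal_naturality (x : QPTrans (E.map F) (E.map G)) {X Y : A.carrier} (f : X ⟶ Y) :
    F.functor.map f ≫ transVal x Y = transVal x X ≫ G.functor.map f :=
  (isGeneratorClosed_naturalityProperty x).of_hom f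

/-- The even supernatural transformation of degree zero given by a `(Q, Π)`-natural transformation
between restrictions of graded superfunctors. -/
def liftTrans (x : QPTrans (E.map F) (E.map G)) : GSTrans F G where
  app := transVal x
  isSupernatural := .of_natural (transVal_mem x) (transVal_naturality x)

lemma E.val_eqToHom {X Y : (E.obj B).carrier} (h : X = Y) :
    E.val (eqToHom h) = eqToHom (congrArg E.as h) := by
  subst h; rfl

lemma E.map_injective (h : E.map F = E.map G) : F = G := by
  have hf : (E.map F).functor = (E.map G).functor := congrArg QPFunctor.functor h
  have hobj : ∀ X, F.functor.obj X = G.functor.obj X := fun X =>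
    congrArg (fun H => E.as (H.obj (E.of X))) hf
  have happ : ∀ X, transVal (eqToHom h : E.map F ⟶ E.map G) X = eqToHom (hobj X) := fun X =>
    (congrArg E.val (QPTrans.eqToHom_app h (E.of X))).trans (E.val_eqToHom _)
  refine GSFunctor.ext (CategoryTheory.Functor.ext hobj fun X Y f => ?_)
  have h' := transVal_naturality (eqToHom h : E.map F ⟶ E.map G) f
  rw [happ, happ] at h'
  rw [← reassoc_of% h']
  simp

variable (k) in
instance E.faithful_toFunctor : (E.{w, v, u} k).toFunctor.Faithful where
  map_injective := E.map_injective

instance E.full_mapFunctor (A B : QPSupercat.{w, v, u} k) : ((E k).mapFunctor A B).Full where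
  map_surjective x := ⟨liftTrans x, rfl⟩

instance E.faithful_mapFunctor (A B : QPSupercat.{w, v, u} k) :
    ((E k).mapFunctor A B).Faithful where
  map_injective h := GSTrans.hom_ext fun X =>
    congrArg (fun x => E.val (x.trans.app (E.of X))) h

end Generation

end

end QPi

theorem mainTheorem9 (k : Type w) [CommRing k] :
    QPi.IsTwoEquivalence (QPi.E.{w, v, u} k).toPseudofunctor := by
  have : (QPi.E.{w, v, u} k).toFunctor.IsEquivalence := { }
  exact QPi.isTwoEquivalence_of_isEquivalence (QPi.E k)
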